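/- Let $\gamma\in\mathbb{R}$ and $\delta>0$, and let $\psi:\mathbb{N}\to\mathbb{R}_{\ge 0}$ (with $\mathbb{N}=\{1,2,\dots\}$) be a function such that $\psi(q)\ge\delta$ for every $q\in\mathbb{N}$ with $\psi(q)\ne 0$. Suppose that $$\sum_{q=1}^{\infty}\frac{\varphi(q)\,\psi(q)}{q}=\infty,$$ where $\varphi$ is Euler's totient function. For $q\in\mathbb{N}$ let $$E'_q=E'_q(\gamma,\psi):=\left\{x\in[0,1]:\ \left|x-\frac{a+\gamma}{q}\right|\le\frac{\psi(q)}{q}\ \text{ for some } a\in\mathbb{Z} \text{ with } \gcd(a,q)=1\right\}.$$ Then $$\mu\Big(\limsup_{q\to\infty}E'_q\Big)=1,$$ where $\mu$ is Lebesgue measure on $\mathbb{R}$ and $\limsup_{q\to\infty}E'_q$ is the set of points that lie in $E'_q$ for infinitely many $q\in\mathbb{N}$. -/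

import Mathlib

open MeasureTheory Filter
open scoped NNReal

/-- The coprime inhomogeneous approximation set `E'_q(γ, ψ)`: those `x ∈ [0,1]` with
`|x - (a + γ) / q| ≤ ψ(q) / q` for some integer `a` coprime to `q`.
It is meant for `q ≥ 1`; the value at `q = 0` does not affect the limsup as `q → ∞`. -/
def coprimeApproxSet (γ : ℝ) (ψ : ℕ → ℝ≥0) (q : ℕ) : Set ℝ :=
  {x | x ∈ Set.Icc (0 : ℝ) 1 ∧
    ∃ a : ℤ, Int.gcd a (q : ℤ) = 1 ∧ |x - ((a : ℝ) + γ) / (q : ℝ)| ≤ (ψ q : ℝ) / (q : ℝ)}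

/-! Let `f q x` (`approxCount`) count the reduced numerators `a` for which `x` is within `ψ q / q`
of `(a + γ) / q`, and put `w q = φ(q) ψ(q) / q`. Two estimates suffice. Reduced residues
equidistribute, so a fixed interval `I` carries mass at least `|I| w q / 2` once `q` is large
(`eventually_le_setIntegral_approxCount`). And on average the counts are quasi-independent: `∫ f q *
f r ≤ C * w q * w r`, plus `C * w q` when `q = r` (`exists_setIntegral_approxCount_mul_le`).
Divergence of `∑ w q` and Cauchy-Schwarz, localised to a part of the complement of a tail union,
then force that complement to be null (`volume_Icc_diff_iUnion_eq_zero`).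

The overlap estimate is the arithmetic core, and there `ψ ≥ δ` is decisive. Write `q = d m`, `r = d
n` with `m`, `n` coprime. Overlapping balls give `k = a n - b m` of size `O(L)`, where `L = ψ(q) n +
ψ(r) m`; since `L ≥ δ (m + n)`, the shift `γ (n - m)` is absorbed in this bound. For fixed `k` the
solutions form a line, and counting units modulo `d` bounds their number by a multiple of `d ·
φ(q)/q · φ(r)/r · mn/φ(mn) · k/φ(k)` (`card_pairs_le`). The factor `mn/φ(mn)` would be fatal, but
`k` must be coprime to `mn`, and an upper bound sieve saves exactly `φ(mn)/(mn)`
(`exists_sum_coprime_self_div_totient_le`). The sieve needs every prime factor of `mn` to lie in its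
range, which `L ≥ δ (m + n)` again guarantees. -/

/-! ### Elementary bounds for Euler's function. -/

theorem totient_div_eq_prod {n : ℕ} (hn : n ≠ 0) :
    (n.totient : ℝ) / n = ∏ p ∈ n.primeFactors, (1 - (p : ℝ)⁻¹) := by
  have h := Nat.totient_eq_mul_prod_factors n
  have h' : (n.totient : ℝ) = n * ∏ p ∈ n.primeFactors, (1 - (p : ℝ)⁻¹) := by
    have := congrArg (fun x : ℚ => (x : ℝ)) h
    push_cast at this
    exact this
  have hn' : (n : ℝ) ≠ 0 := by exact_mod_cast hn
  rw [h']; field_simp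

theorem one_sub_inv_prime_pos {p : ℕ} (hp : p.Prime) : 0 < 1 - (p : ℝ)⁻¹ := by
  have : (1 : ℝ) < p := by exact_mod_cast hp.one_lt
  have := inv_lt_one_of_one_lt₀ this
  linarith

theorem prod_primeFactors_pred_le_totient {n : ℕ} (hn : n ≠ 0) :
    ∏ p ∈ n.primeFactors, (p - 1) ≤ n.totient := by
  have h := Nat.totient_mul_prod_primeFactors n
  have h1 : ∏ p ∈ n.primeFactors, p ≤ n :=
    Nat.le_of_dvd (Nat.pos_of_ne_zero hn) (Nat.prod_primeFactors_dvd n)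
  have h2 : 0 < ∏ p ∈ n.primeFactors, p :=
    Finset.prod_pos fun p hp => (Nat.prime_of_mem_primeFactors hp).pos
  by_contra! hlt
  have : n.totient * ∏ p ∈ n.primeFactors, p < n * ∏ p ∈ n.primeFactors, (p - 1) :=
    calc _ < (∏ p ∈ n.primeFactors, (p - 1)) * ∏ p ∈ n.primeFactors, p :=
          Nat.mul_lt_mul_of_pos_right hlt h2
      _ ≤ (∏ p ∈ n.primeFactors, (p - 1)) * n := Nat.mul_le_mul_left _ h1
      _ = _ := mul_comm _ _
  omega

/-- Primes `p ≥ 5` satisfy `4 ≤ p - 1`; the primes 2 and 3 cost at most `4 ^ 2`. This makes the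
sieve error `2 ^ ω(n)` of order at most the square root of `φ(n)`. -/
theorem four_pow_card_primeFactors_le {n : ℕ} (hn : n ≠ 0) :
    4 ^ n.primeFactors.card ≤ 16 * n.totient := by
  have hg : ∏ p ∈ n.primeFactors, (if p = 2 ∨ p = 3 then 4 else 1) ≤ 16 := by
    rw [Finset.prod_ite]
    simp only [Finset.prod_const, mul_one, one_pow]
    have : (n.primeFactors.filter (fun p => p = 2 ∨ p = 3)).card ≤ 2 := by
      have hs : n.primeFactors.filter (fun p => p = 2 ∨ p = 3) ⊆ {2, 3} := by
        intro p hp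
        have := (Finset.mem_filter.1 hp).2
        simpa using this
      exact (Finset.card_le_card hs).trans (by simp)
    calc _ ≤ 4 ^ 2 := Nat.pow_le_pow_right (by norm_num) this
      _ = 16 := by norm_num
  calc 4 ^ n.primeFactors.card = ∏ p ∈ n.primeFactors, 4 := by simp
    _ ≤ ∏ p ∈ n.primeFactors, ((if p = 2 ∨ p = 3 then 4 else 1) * (p - 1)) := by
        refine Finset.prod_le_prod' fun p hp => ?_
        have hp := Nat.prime_of_mem_primeFactors hp
        split_ifs with h
        · rcases h with rfl | rfl <;> norm_num
        · have h2 := hp.two_le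
          have h4 : p ≠ 4 := by rintro rfl; revert hp; norm_num
          omega
    _ ≤ 16 * n.totient := by
        rw [Finset.prod_mul_distrib]
        exact Nat.mul_le_mul hg (prod_primeFactors_pred_le_totient hn)

/-- From `p ≤ 2 (p - 1)` one gets `n ≤ 2 ^ ω(n) φ(n)`; square and apply the previous bound. The
resulting `φ(n) ≫ n ^ (2/3)` is all the growth needed later. -/
theorem sq_le_sixteen_mul_totient_cube (n : ℕ) : n ^ 2 ≤ 16 * n.totient ^ 3 := by
  rcases eq_or_ne n 0 with rfl | hn
  · simp
  have h := Nat.totient_mul_prod_primeFactors n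
  have h1 : ∏ p ∈ n.primeFactors, p ≤ 2 ^ n.primeFactors.card * ∏ p ∈ n.primeFactors, (p - 1) := by
    rw [← Finset.prod_const, ← Finset.prod_mul_distrib]
    refine Finset.prod_le_prod' fun p hp => ?_
    have := (Nat.prime_of_mem_primeFactors hp).two_le
    omega
  have h2 : 0 < ∏ p ∈ n.primeFactors, (p - 1) :=
    Finset.prod_pos fun p hp => by
      have := (Nat.prime_of_mem_primeFactors hp).two_le
      omega
  have h3 : n ≤ n.totient * 2 ^ n.primeFactors.card := by
    refine Nat.le_of_mul_le_mul_right ?_ h2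
    calc _ = n.totient * ∏ p ∈ n.primeFactors, p := h.symm
      _ ≤ n.totient * (2 ^ n.primeFactors.card * ∏ p ∈ n.primeFactors, (p - 1)) :=
          Nat.mul_le_mul_left _ h1
      _ = _ := by ring
  calc n ^ 2 ≤ (n.totient * 2 ^ n.primeFactors.card) ^ 2 := Nat.pow_le_pow_left h3 2
    _ = n.totient ^ 2 * 4 ^ n.primeFactors.card := by
        rw [mul_pow, ← pow_mul, mul_comm n.primeFactors.card, pow_mul]; norm_num
    _ ≤ n.totient ^ 2 * (16 * n.totient) := Nat.mul_le_mul_left _ (four_pow_card_primeFactors_le hn)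
    _ = _ := by ring

theorem tendsto_totient_atTop : Tendsto (fun n : ℕ => n.totient) atTop atTop := by
  rw [tendsto_atTop]
  intro b
  filter_upwards [eventually_gt_atTop (16 * b ^ 3)] with n hn
  by_contra! h
  have h1 := sq_le_sixteen_mul_totient_cube n
  have h2 : n.totient ^ 3 ≤ b ^ 3 := Nat.pow_le_pow_left h.le 3
  nlinarith

/-- Divide `n = ∑ φ(n / e)` by `φ(n)` and use `φ(e) φ(n / e) ≤ φ(n)`. -/
theorem self_div_totient_le_sum_divisors (n : ℕ) :
    (n : ℝ) / n.totient ≤ ∑ e ∈ n.divisors, (1 : ℝ) / e.totient := by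
  rcases eq_or_ne n 0 with rfl | hn
  · simp
  have hpos : (0 : ℝ) < n.totient := by exact_mod_cast Nat.totient_pos.2 (Nat.pos_of_ne_zero hn)
  have h : (n : ℝ) = ∑ e ∈ n.divisors, ((n / e).totient : ℝ) := by
    rw [Nat.sum_div_divisors n (fun e => (e.totient : ℝ))]
    exact_mod_cast (Nat.sum_totient n).symm
  rw [div_le_iff₀ hpos, Finset.sum_mul]
  conv_lhs => rw [h]
  refine Finset.sum_le_sum fun e he => ?_
  have hd := Nat.dvd_of_mem_divisors he
  have he0 : 0 < e := Nat.pos_of_mem_divisors he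
  have hepos : (0 : ℝ) < e.totient := by exact_mod_cast Nat.totient_pos.2 he0
  have := Nat.totient_super_multiplicative e (n / e)
  rw [Nat.mul_div_cancel' hd] at this
  rw [one_div, inv_mul_eq_div, le_div_iff₀ hepos, mul_comm]
  exact_mod_cast this

/-! ### Mertens' upper bounds. -/

-- Sum `Λ * 1 = log` up to `N`; replacing `⌊N / n⌋` by `N / n` costs at most Chebyshev's function,
-- which is `O(N)`.
open ArithmeticFunction in
theorem sum_vonMangoldt_div_le {N : ℕ} (hN : N ≠ 0) :
    ∑ n ∈ Finset.Ioc 0 N, vonMangoldt n / n ≤ Real.log N + (Real.log 4 + 4) := by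
  have hN' : (0 : ℝ) < N := by exact_mod_cast Nat.pos_of_ne_zero hN
  have h := sum_Ioc_mul_zeta_eq_sum vonMangoldt N
  rw [vonMangoldt_mul_zeta] at h
  have hlog : ∑ n ∈ Finset.Ioc 0 N, ArithmeticFunction.log n ≤ N * Real.log N := by
    calc _ ≤ ∑ n ∈ Finset.Ioc 0 N, Real.log N := by
          refine Finset.sum_le_sum fun n hn => ?_
          rw [Finset.mem_Ioc] at hn
          rw [log_apply]
          exact Real.log_le_log (by exact_mod_cast hn.1) (by exact_mod_cast hn.2)
      _ = _ := by simp
  have hpsi := Chebyshev.psi_le_const_mul_self hN'.le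
  have hpsi' : Chebyshev.psi N = ∑ n ∈ Finset.Ioc 0 N, vonMangoldt n := by
    simp [Chebyshev.psi]
  have key : N * ∑ n ∈ Finset.Ioc 0 N, vonMangoldt n / n ≤
      ∑ n ∈ Finset.Ioc 0 N, vonMangoldt n * ↑(N / n) + ∑ n ∈ Finset.Ioc 0 N, vonMangoldt n := by
    rw [Finset.mul_sum, ← Finset.sum_add_distrib]
    refine Finset.sum_le_sum fun n hn => ?_
    have h1 : (N : ℝ) / n ≤ ((N / n : ℕ) : ℝ) + 1 := by
      rw [← Nat.floor_div_eq_div (K := ℝ)]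
      exact (Nat.lt_floor_add_one _).le
    have := mul_le_mul_of_nonneg_left h1 (vonMangoldt_nonneg (n := n))
    calc _ = vonMangoldt n * ((N : ℝ) / n) := by ring
      _ ≤ _ := this
      _ = _ := by ring
  rw [← h, ← hpsi'] at key
  refine le_of_mul_le_mul_left ?_ hN'
  calc _ ≤ _ := key
    _ ≤ N * Real.log N + (Real.log 4 + 4) * N := add_le_add hlog hpsi
    _ = _ := by ring

/-- The completely multiplicative function `n ↦ n ^ (-s)` on the natural numbers. -/
noncomputable def rpowNegHom (s : ℝ) : ℕ →* ℝ where
  toFun n := (n : ℝ) ^ (-s)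
  map_one' := by simp
  map_mul' a b := by
    push_cast
    exact Real.mul_rpow (Nat.cast_nonneg a) (Nat.cast_nonneg b)

theorem rpowNegHom_apply (s : ℝ) (n : ℕ) : rpowNegHom s n = (n : ℝ) ^ (-s) := rfl

theorem summable_rpowNegHom {s : ℝ} (hs : 1 < s) : Summable (rpowNegHom s) :=
  Real.summable_nat_rpow.2 (by linarith)

theorem tsum_rpowNegHom_le {s : ℝ} (hs : 1 < s) : ∑' n, rpowNegHom s n ≤ 1 + 1 / (s - 1) := by
  have h := ZetaAsymptotics.zeta_limit_aux1 hs
  have h0 : 0 ≤ ZetaAsymptotics.termTSum s :=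
    tsum_nonneg fun n => ZetaAsymptotics.term_nonneg (n + 1) s
  have h1 : 0 ≤ s * ZetaAsymptotics.termTSum s := mul_nonneg (by linarith) h0
  rw [(summable_rpowNegHom hs).tsum_eq_zero_add]
  have h2 : ∑' n : ℕ, rpowNegHom s (n + 1) = ∑' n : ℕ, 1 / (n + 1 : ℝ) ^ s := by
    refine tsum_congr fun n => ?_
    rw [rpowNegHom_apply, Real.rpow_neg (by positivity), one_div]
    push_cast
    rfl
  have h3 : rpowNegHom s 0 = 0 := by
    rw [rpowNegHom_apply, Nat.cast_zero, Real.zero_rpow (by linarith)]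
  rw [h2, h3]
  linarith

theorem prod_one_sub_rpow_inv_le {s : ℝ} (hs : 1 < s) (S : Finset ℕ) :
    ∏ p ∈ S with p.Prime, (1 - (p : ℝ) ^ (-s))⁻¹ ≤ 1 + 1 / (s - 1) := by
  have h := EulerProduct.prod_filter_prime_geometric_eq_tsum_factoredNumbers
    (summable_rpowNegHom hs) S
  simp only [rpowNegHom_apply] at h
  rw [h]
  refine le_trans ?_ (tsum_rpowNegHom_le hs)
  exact (summable_rpowNegHom hs).tsum_subtype_le _ _ (fun n => Real.rpow_nonneg (Nat.cast_nonneg n) _)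

theorem sum_log_div_prime_le {N : ℕ} (hN : N ≠ 0) :
    ∑ p ∈ Finset.Ioc 0 N with p.Prime, Real.log p / p ≤ Real.log N + (Real.log 4 + 4) := by
  refine le_trans ?_ (sum_vonMangoldt_div_le hN)
  rw [Finset.sum_filter]
  refine Finset.sum_le_sum fun n _ => ?_
  split_ifs with h
  · rw [ArithmeticFunction.vonMangoldt_apply_prime h]
  · exact div_nonneg ArithmeticFunction.vonMangoldt_nonneg (Nat.cast_nonneg n)

/-- Moving the Euler factor from exponent `1` to `1 + σ` costs a factor at most `1 + 2 σ log p / p`,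
by `1 - y ≤ exp (-y)` and `1 / p ≤ 1 / 2`. -/
theorem inv_one_sub_inv_le_mul_exp {p : ℕ} (hp : p.Prime) {σ : ℝ} (hσ : 0 < σ) :
    (1 - (p : ℝ)⁻¹)⁻¹ ≤
      (1 - (p : ℝ) ^ (-(1 + σ)))⁻¹ * Real.exp (2 * σ * (Real.log p / p)) := by
  have hp2 : (2 : ℝ) ≤ p := by exact_mod_cast hp.two_le
  have hp0 : (0 : ℝ) < p := by linarith
  have hu : 0 < 1 - (p : ℝ)⁻¹ := one_sub_inv_prime_pos hp
  have hinv : (p : ℝ)⁻¹ ≤ 1 / 2 := by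
    rw [one_div]; exact inv_anti₀ (by norm_num) hp2
  have hinv0 : 0 < (p : ℝ)⁻¹ := by positivity
  have hlog : 0 ≤ Real.log p := Real.log_nonneg (by linarith)
  have hx : (p : ℝ) ^ (-(1 + σ)) = (p : ℝ)⁻¹ * Real.exp (-(σ * Real.log p)) := by
    rw [neg_add, Real.rpow_add hp0, Real.rpow_neg_one, Real.rpow_def_of_pos hp0]
    congr 2
    ring
  have hexp : 1 - σ * Real.log p ≤ Real.exp (-(σ * Real.log p)) := by
    have := Real.add_one_le_exp (-(σ * Real.log p))
    linarith
  have hexp1 : Real.exp (-(σ * Real.log p)) ≤ 1 :=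
    Real.exp_le_one_iff.2 (by have := mul_nonneg hσ.le hlog; linarith)
  have hv : 0 < 1 - (p : ℝ) ^ (-(1 + σ)) := by
    rw [hx]
    nlinarith
  rw [inv_mul_eq_div, le_div_iff₀ hv, inv_mul_eq_div, div_le_iff₀ hu]
  have hE := Real.add_one_le_exp (2 * σ * (Real.log p / p))
  have h1 : 1 - (p : ℝ) ^ (-(1 + σ)) ≤
      (2 * σ * (Real.log p / p) + 1) * (1 - (p : ℝ)⁻¹) := by
    rw [hx, div_eq_mul_inv]
    have ha : 0 ≤ σ * Real.log p * (p : ℝ)⁻¹ := by positivity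
    nlinarith [mul_le_mul_of_nonneg_left hexp hinv0.le, mul_le_mul_of_nonneg_left hinv ha]
  exact h1.trans (mul_le_mul_of_nonneg_right hE hu.le)

/-- The upper bound in Mertens' third theorem. -/
theorem exists_prod_primes_inv_le_log :
    ∃ C : ℝ, 0 < C ∧ ∀ N : ℕ, 2 ≤ N →
      ∏ p ∈ Finset.Ioc 0 N with p.Prime, (1 - (p : ℝ)⁻¹)⁻¹ ≤ C * Real.log N := by
  have hlog2 : 0 < Real.log 2 := Real.log_pos (by norm_num)
  set A : ℝ := Real.log 4 + 4 with hA
  have hA0 : 0 < A := by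
    have : 0 ≤ Real.log 4 := Real.log_nonneg (by norm_num)
    linarith
  refine ⟨(1 / Real.log 2 + 1) * Real.exp (2 * (1 + A / Real.log 2)), by positivity, ?_⟩
  intro N hN
  have hN0 : N ≠ 0 := by omega
  have hlogN : Real.log 2 ≤ Real.log N :=
    Real.log_le_log (by norm_num) (by exact_mod_cast hN)
  have hlogN0 : 0 < Real.log N := hlog2.trans_le hlogN
  -- This choice makes the bound `1 + 1 / σ` for the zeta factor of order `log N`, while `σ ∑ log p
  -- / p` stays bounded.
  set σ : ℝ := 1 / Real.log N with hσ
  have hσ0 : 0 < σ := by positivity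
  calc ∏ p ∈ Finset.Ioc 0 N with p.Prime, (1 - (p : ℝ)⁻¹)⁻¹
      ≤ ∏ p ∈ Finset.Ioc 0 N with p.Prime,
        ((1 - (p : ℝ) ^ (-(1 + σ)))⁻¹ * Real.exp (2 * σ * (Real.log p / p))) := by
        refine Finset.prod_le_prod (fun p hp => ?_) fun p hp => ?_
        · exact (inv_pos.2 (one_sub_inv_prime_pos (Finset.mem_filter.1 hp).2)).le
        · exact inv_one_sub_inv_le_mul_exp (Finset.mem_filter.1 hp).2 hσ0
    _ = (∏ p ∈ Finset.Ioc 0 N with p.Prime, (1 - (p : ℝ) ^ (-(1 + σ)))⁻¹) *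
        Real.exp (2 * σ * ∑ p ∈ Finset.Ioc 0 N with p.Prime, Real.log p / p) := by
        rw [Finset.prod_mul_distrib, ← Real.exp_sum, ← Finset.mul_sum]
    _ ≤ (1 + 1 / (1 + σ - 1)) * Real.exp (2 * (1 + A / Real.log 2)) := by
        have h1 := prod_one_sub_rpow_inv_le (s := 1 + σ) (by linarith) (Finset.Ioc 0 N)
        have h2 := sum_log_div_prime_le hN0
        refine mul_le_mul h1 (Real.exp_le_exp.2 ?_) (Real.exp_pos _).le ?_
        · rw [mul_assoc]
          refine mul_le_mul_of_nonneg_left ?_ (by norm_num)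
          calc _ ≤ σ * (Real.log N + A) := mul_le_mul_of_nonneg_left h2 hσ0.le
            _ = 1 + A / Real.log N := by rw [hσ]; field_simp
            _ ≤ _ := by gcongr
        · have : (0 : ℝ) < 1 + σ - 1 := by linarith
          positivity
    _ ≤ _ := by
        have : (1 + 1 / (1 + σ - 1)) ≤ (1 / Real.log 2 + 1) * Real.log N := by
          have e : 1 + 1 / (1 + σ - 1) = 1 + Real.log N := by rw [hσ]; field_simp; ring
          rw [e, add_mul, one_mul]
          have : 1 ≤ 1 / Real.log 2 * Real.log N := by
            rw [one_div, inv_mul_eq_div, le_div_iff₀ hlog2]; linarith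
          linarith
        calc _ ≤ (1 / Real.log 2 + 1) * Real.log N * Real.exp (2 * (1 + A / Real.log 2)) :=
              mul_le_mul_of_nonneg_right this (Real.exp_pos _).le
          _ = _ := by ring

/-! ### An upper bound sieve. -/

/-- Each such `l` is a product of primes up to `N` not dividing `P`, so its term occurs in the
expanded Euler product. -/
theorem sum_coprime_inv_le_prod (N P : ℕ) :
    ∑ l ∈ Finset.Ioc 0 N with l.Coprime P, (l : ℝ)⁻¹ ≤
      ∏ p ∈ Finset.Ioc 0 N with p.Prime ∧ ¬ p ∣ P, (1 - (p : ℝ)⁻¹)⁻¹ := by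
  set S := (Finset.Ioc 0 N).filter (fun p => ¬ p ∣ P) with hS
  have h := EulerProduct.summable_and_hasSum_factoredNumbers_prod_filter_prime_geometric
    (f := rpowNegHom 1) (fun {p} hp => by
      rw [rpowNegHom_apply, Real.rpow_neg_one, Real.norm_of_nonneg (by positivity)]
      exact inv_lt_one_of_one_lt₀ (by exact_mod_cast hp.one_lt)) S
  obtain ⟨-, h2⟩ := h
  simp only [rpowNegHom_apply, Real.rpow_neg_one] at h2
  have hfil : S.filter Nat.Prime = (Finset.Ioc 0 N).filter (fun p => p.Prime ∧ ¬ p ∣ P) := by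
    rw [hS, Finset.filter_filter]
    simp only [and_comm]
  rw [← hfil]
  set T := (Finset.Ioc 0 N).filter (fun l => l.Coprime P) with hT
  have hmem : ∀ l ∈ T, l ∈ Nat.factoredNumbers S := by
    intro l hl
    rw [hT, Finset.mem_filter, Finset.mem_Ioc] at hl
    refine Nat.mem_factoredNumbers_of_primeFactors_subset (by omega) ?_
    intro p hp
    rw [Nat.mem_primeFactors] at hp
    rw [hS, Finset.mem_filter, Finset.mem_Ioc]
    refine ⟨⟨hp.1.pos, (Nat.le_of_dvd hl.1.1 hp.2.1).trans hl.1.2⟩, fun hpP => ?_⟩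
    exact hp.1.one_lt.ne' (Nat.eq_one_of_dvd_coprimes hl.2 hp.2.1 hpP)
  calc ∑ l ∈ T, (l : ℝ)⁻¹ = ∑ l ∈ T.attach, (l.1 : ℝ)⁻¹ := (Finset.sum_attach _ _).symm
    _ = ∑ l ∈ T.attach.map ⟨fun l : {x // x ∈ T} =>
          (⟨l.1, hmem l.1 l.2⟩ : Nat.factoredNumbers S),
          fun a b hab => Subtype.ext (congrArg (fun z : Nat.factoredNumbers S => z.1) hab)⟩,
          ((l : ℕ) : ℝ)⁻¹ := by rw [Finset.sum_map]; rfl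
    _ ≤ _ := sum_le_hasSum _ (fun i _ => by positivity) h2

/-- The factors at `p ∣ P` are removed from Mertens' product. All of them occur in it because the
primes of `P` are at most `N`, so the full `φ(P) / P` is saved. -/
theorem exists_sum_coprime_inv_le :
    ∃ C : ℝ, 0 < C ∧ ∀ N P : ℕ, 2 ≤ N → P ≠ 0 → (∀ p ∈ P.primeFactors, p ≤ N) →
      ∑ l ∈ Finset.Ioc 0 N with l.Coprime P, (l : ℝ)⁻¹ ≤
        C * Real.log N * ((P.totient : ℝ) / P) := by
  obtain ⟨C, hC, h⟩ := exists_prod_primes_inv_le_log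
  refine ⟨C, hC, fun N P hN hP hPN => ?_⟩
  refine (sum_coprime_inv_le_prod N P).trans ?_
  have hsplit := Finset.prod_filter_mul_prod_filter_not
    ((Finset.Ioc 0 N).filter Nat.Prime) (fun p => p ∣ P) (fun p => (1 - (p : ℝ)⁻¹)⁻¹)
  rw [Finset.filter_filter, Finset.filter_filter] at hsplit
  have hfil : (Finset.Ioc 0 N).filter (fun p => p.Prime ∧ p ∣ P) = P.primeFactors := by
    ext p
    rw [Finset.mem_filter, Finset.mem_Ioc, Nat.mem_primeFactors]
    constructor
    · rintro ⟨-, h1, h2⟩; exact ⟨h1, h2, hP⟩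
    · rintro ⟨h1, h2, h3⟩
      exact ⟨⟨h1.pos, hPN p (Nat.mem_primeFactors.2 ⟨h1, h2, h3⟩)⟩, h1, h2⟩
  rw [hfil, Finset.prod_inv_distrib, ← totient_div_eq_prod hP] at hsplit
  have hu : (0 : ℝ) < (P.totient : ℝ) / P := by
    have : 0 < P.totient := Nat.totient_pos.2 (Nat.pos_of_ne_zero hP)
    positivity
  have := h N hN
  rw [← hsplit, inv_mul_eq_div, div_le_iff₀ hu] at this
  exact this

theorem exists_sum_inv_mul_totient_le :
    ∃ C : ℝ, 0 < C ∧ ∀ N : ℕ, ∑ e ∈ Finset.Ioc 0 N, ((e : ℝ) * e.totient)⁻¹ ≤ C := by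
  have hs : Summable (fun n : ℕ => 3 * (n : ℝ) ^ (-(5 / 3 : ℝ))) :=
    (Real.summable_nat_rpow.2 (by norm_num)).mul_left _
  refine ⟨1 + ∑' n : ℕ, 3 * (n : ℝ) ^ (-(5 / 3 : ℝ)), by positivity, fun N => ?_⟩
  have h1 := hs.sum_le_tsum (Finset.Ioc 0 N) (fun n _ => by positivity)
  refine le_trans (Finset.sum_le_sum fun e he => ?_) (h1.trans (by linarith))
  have he0 : 0 < e := (Finset.mem_Ioc.1 he).1
  have he' : (0 : ℝ) < e := by exact_mod_cast he0
  have ht : (0 : ℝ) < e.totient := by exact_mod_cast Nat.totient_pos.2 he0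
  have hcube : (e : ℝ) ^ 2 ≤ 16 * (e.totient : ℝ) ^ 3 := by
    exact_mod_cast sq_le_sixteen_mul_totient_cube e
  set y : ℝ := (e : ℝ) ^ (1 / 3 : ℝ) with hy
  have hy0 : 0 < y := Real.rpow_pos_of_pos he' _
  have hye : (e : ℝ) = y ^ 3 := by
    rw [hy, ← Real.rpow_natCast, ← Real.rpow_mul he'.le]; norm_num
  have hpow : (e : ℝ) ^ (-(5 / 3 : ℝ)) = (y ^ 5)⁻¹ := by
    rw [Real.rpow_neg he'.le, hy, ← Real.rpow_natCast, ← Real.rpow_mul he'.le]; norm_num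
  have hle : y ^ 2 ≤ 3 * e.totient := by
    refine le_of_pow_le_pow_left₀ (n := 3) (by norm_num) (by positivity) ?_
    rw [hye] at hcube
    calc (y ^ 2) ^ 3 = (y ^ 3) ^ 2 := by ring
      _ ≤ 16 * (e.totient : ℝ) ^ 3 := hcube
      _ ≤ 27 * (e.totient : ℝ) ^ 3 := by gcongr; norm_num
      _ = _ := by ring
  rw [hpow, ← div_eq_mul_inv, inv_eq_one_div, div_le_div_iff₀ (by positivity) (by positivity)]
  calc 1 * y ^ 5 = y ^ 3 * y ^ 2 := by ring
    _ ≤ y ^ 3 * (3 * e.totient) := by gcongr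
    _ = 3 * ((e : ℝ) * e.totient) := by rw [hye]; ring

theorem sum_Ioc_sum_divisors {R : Type*} [AddCommMonoid R] (N : ℕ) (G : ℕ → ℕ → R) :
    ∑ n ∈ Finset.Ioc 0 N, ∑ e ∈ n.divisors, G e (n / e) =
      ∑ e ∈ Finset.Ioc 0 N, ∑ l ∈ Finset.Ioc 0 (N / e), G e l := by
  have h1 : ∑ n ∈ Finset.Ioc 0 N, ∑ e ∈ n.divisors, G e (n / e) =
      ∑ n ∈ Finset.Ioc 0 N,
        ∑ x ∈ Finset.Ioc 0 N ×ˢ Finset.Ioc 0 N with x.1 * x.2 = n, G x.1 x.2 := by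
    refine Finset.sum_congr rfl fun n hn => ?_
    rw [Finset.mem_Ioc] at hn
    rw [← Nat.sum_divisorsAntidiagonal, Nat.divisorsAntidiagonal_eq_prod_filter_of_le hn.1.ne' hn.2]
  have h2 : ∑ n ∈ Finset.Ioc 0 N,
        ∑ x ∈ Finset.Ioc 0 N ×ˢ Finset.Ioc 0 N with x.1 * x.2 = n, G x.1 x.2 =
      ∑ x ∈ Finset.Ioc 0 N ×ˢ Finset.Ioc 0 N with x.1 * x.2 ≤ N, G x.1 x.2 := by
    simp_rw [Finset.sum_filter]
    rw [Finset.sum_comm]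
    exact Finset.sum_congr rfl fun _ _ ↦ (by simp_all)
  rw [h1, h2, Finset.sum_filter, Finset.sum_product]
  refine Finset.sum_congr rfl fun e he => ?_
  rw [← Finset.sum_filter]
  refine Finset.sum_congr ?_ fun _ _ => rfl
  ext l
  rw [Finset.mem_Ioc] at he
  simp only [Finset.mem_filter, Finset.mem_Ioc]
  rw [Nat.le_div_iff_mul_le he.1, mul_comm l e]
  constructor
  · rintro ⟨⟨h1, -⟩, h2⟩; exact ⟨h1, h2⟩
  · rintro ⟨h1, h2⟩; exact ⟨⟨h1, (Nat.le_mul_of_pos_left l he.1).trans h2⟩, h2⟩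

/-- Expanding `l / φ(l)` over divisors `e` leaves cofactors `l / e` still coprime to `P`; the sum
over `e` converges. -/
theorem exists_sum_coprime_inv_totient_le :
    ∃ C : ℝ, 0 < C ∧ ∀ N P : ℕ, 2 ≤ N → P ≠ 0 → (∀ p ∈ P.primeFactors, p ≤ N) →
      ∑ l ∈ Finset.Ioc 0 N with l.Coprime P, (l.totient : ℝ)⁻¹ ≤
        C * Real.log N * ((P.totient : ℝ) / P) := by
  obtain ⟨C₁, hC₁, h₁⟩ := exists_sum_coprime_inv_le
  obtain ⟨C₂, hC₂, h₂⟩ := exists_sum_inv_mul_totient_le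
  refine ⟨C₂ * C₁, by positivity, fun N P hN hP hPN => ?_⟩
  let G : ℕ → ℕ → ℝ := fun e l => ((e : ℝ) * e.totient)⁻¹ * if l.Coprime P then (l : ℝ)⁻¹ else 0
  have hG : ∀ e l, 0 ≤ G e l := fun e l => by
    simp only [G]; split_ifs <;> positivity
  calc ∑ l ∈ Finset.Ioc 0 N with l.Coprime P, (l.totient : ℝ)⁻¹
      ≤ ∑ l ∈ Finset.Ioc 0 N, ∑ e ∈ l.divisors, G e (l / e) := by
        rw [Finset.sum_filter]
        refine Finset.sum_le_sum fun l hl => ?_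
        split_ifs with hco
        · have hl0 : 0 < l := (Finset.mem_Ioc.1 hl).1
          have hl' : (0 : ℝ) < l := by exact_mod_cast hl0
          have h := self_div_totient_le_sum_divisors l
          calc (l.totient : ℝ)⁻¹ = (l : ℝ)⁻¹ * (l / l.totient) := by field_simp
            _ ≤ (l : ℝ)⁻¹ * ∑ e ∈ l.divisors, (1 : ℝ) / e.totient := by gcongr
            _ = ∑ e ∈ l.divisors, G e (l / e) := by
                rw [Finset.mul_sum]
                refine Finset.sum_congr rfl fun e he => ?_
                have hd := Nat.dvd_of_mem_divisors he
                have he0 : 0 < e := Nat.pos_of_mem_divisors he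
                have he' : (0 : ℝ) < e := by exact_mod_cast he0
                have ht : (0 : ℝ) < e.totient := by exact_mod_cast Nat.totient_pos.2 he0
                have hc : (l / e).Coprime P := hco.coprime_dvd_left (Nat.div_dvd_of_dvd hd)
                simp only [G, if_pos hc]
                rw [Nat.cast_div hd he'.ne']
                field_simp
        · exact Finset.sum_nonneg fun e _ => hG _ _
    _ = ∑ e ∈ Finset.Ioc 0 N, ∑ l ∈ Finset.Ioc 0 (N / e), G e l := sum_Ioc_sum_divisors N G
    _ ≤ ∑ e ∈ Finset.Ioc 0 N, ∑ l ∈ Finset.Ioc 0 N, G e l := by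
        refine Finset.sum_le_sum fun e _ => ?_
        refine Finset.sum_le_sum_of_subset_of_nonneg ?_ fun l _ _ => hG _ _
        exact Finset.Ioc_subset_Ioc_right (Nat.div_le_self N e)
    _ = (∑ e ∈ Finset.Ioc 0 N, ((e : ℝ) * e.totient)⁻¹) *
          ∑ l ∈ Finset.Ioc 0 N with l.Coprime P, (l : ℝ)⁻¹ := by
        rw [Finset.sum_mul_sum]
        refine Finset.sum_congr rfl fun e _ => ?_
        rw [← Finset.mul_sum, ← Finset.mul_sum, Finset.sum_filter]
    _ ≤ C₂ * (C₁ * Real.log N * ((P.totient : ℝ) / P)) := by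
        refine mul_le_mul (h₂ N) (h₁ N P hN hP hPN) ?_ hC₂.le
        exact Finset.sum_nonneg fun l _ => by positivity
    _ = _ := by ring

theorem self_div_totient_mul_le (a b : ℕ) (ha : a ≠ 0) (hb : b ≠ 0) :
    ((a * b : ℕ) : ℝ) / (a * b).totient ≤ (a : ℝ) / a.totient * (b / b.totient) := by
  have ha' : (0 : ℝ) < a.totient := by exact_mod_cast Nat.totient_pos.2 (Nat.pos_of_ne_zero ha)
  have hb' : (0 : ℝ) < b.totient := by exact_mod_cast Nat.totient_pos.2 (Nat.pos_of_ne_zero hb)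
  rw [div_mul_div_comm]
  push_cast
  refine div_le_div_of_nonneg_left (by positivity) (by positivity) ?_
  exact_mod_cast Nat.totient_super_multiplicative a b

theorem self_div_totient_le_two_of_isPrimePow {e : ℕ} (he : IsPrimePow e) :
    (e : ℝ) / e.totient ≤ 2 := by
  obtain ⟨p, k, hp, hk, rfl⟩ := (isPrimePow_nat_iff e).1 he
  have hpos : 0 < (p ^ k).totient := Nat.totient_pos.2 (pow_pos hp.pos k)
  rw [div_le_iff₀ (by exact_mod_cast hpos)]
  have h : p ^ k ≤ 2 * (p ^ k).totient := by
    obtain ⟨k, rfl⟩ : ∃ j, k = j + 1 := ⟨k - 1, by omega⟩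
    rw [Nat.totient_prime_pow_succ hp, pow_succ]
    have := hp.two_le
    calc p ^ k * p ≤ p ^ k * (2 * (p - 1)) := Nat.mul_le_mul_left _ (by omega)
      _ = _ := by ring
  exact_mod_cast h

/-- An upper bound sieve for integers coprime to `P`, weighted by `k / φ(k)`. -/
theorem exists_sum_coprime_self_div_totient_le :
    ∃ C : ℝ, 0 < C ∧ ∀ N P : ℕ, 2 ≤ N → P ≠ 0 → (∀ p ∈ P.primeFactors, p ≤ N) →
      ∑ k ∈ Finset.Ioc 0 N with k.Coprime P, (k : ℝ) / k.totient ≤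
        C * N * ((P.totient : ℝ) / P) := by
  obtain ⟨C, hC, h⟩ := exists_sum_coprime_inv_totient_le
  set A : ℝ := Real.log 4 + 4 with hA
  have hA0 : 0 < A := by
    have : 0 ≤ Real.log 4 := Real.log_nonneg (by norm_num)
    linarith
  refine ⟨(2 * A + 1) * C, by positivity, fun N P hN hP hPN => ?_⟩
  have hlogN : 0 < Real.log N := Real.log_pos (by exact_mod_cast hN)
  have hNpos : (0 : ℝ) < N := by exact_mod_cast (by omega : 0 < N)
  let f : ℕ → ℝ := fun k => if k.Coprime P then (k : ℝ) / k.totient else 0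
  have hf0 : ∀ k, 0 ≤ f k := fun k => by simp only [f]; split_ifs <;> positivity
  have hfs : ∑ l ∈ Finset.Ioc 0 N, f l / l =
      ∑ l ∈ Finset.Ioc 0 N with l.Coprime P, (l.totient : ℝ)⁻¹ := by
    rw [Finset.sum_filter]
    refine Finset.sum_congr rfl fun l hl => ?_
    have hl0 : (l : ℝ) ≠ 0 := by exact_mod_cast (Finset.mem_Ioc.1 hl).1.ne'
    simp only [f]
    split_ifs
    · field_simp
    · simp
  have hswap := sum_Ioc_sum_divisors N fun l e => 2 * f l * ArithmeticFunction.vonMangoldt e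
  -- Write `log k` as a sum of `Λ(e)` over `k = l e`. Only prime powers `e` matter, and for these `f
  -- (l * e) ≤ 2 * f l`; Chebyshev then bounds the sum over `e`. This trades the sum of `f` for the
  -- logarithmic sum of `f l / l`.
  have hlogk : ∑ k ∈ Finset.Ioc 0 N, f k * Real.log k ≤
      2 * A * N * ∑ l ∈ Finset.Ioc 0 N, f l / l := by
    calc ∑ k ∈ Finset.Ioc 0 N, f k * Real.log k
        ≤ ∑ k ∈ Finset.Ioc 0 N, ∑ l ∈ k.divisors,
            2 * f l * ArithmeticFunction.vonMangoldt (k / l) := by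
          refine Finset.sum_le_sum fun k hk => ?_
          have hk0 : 0 < k := (Finset.mem_Ioc.1 hk).1
          rw [← ArithmeticFunction.vonMangoldt_sum, ← Nat.sum_div_divisors, Finset.mul_sum]
          refine Finset.sum_le_sum fun l hl => ?_
          have hd := Nat.dvd_of_mem_divisors hl
          have hl0 : 0 < l := Nat.pos_of_mem_divisors hl
          obtain ⟨e, rfl⟩ := hd
          rw [Nat.mul_div_cancel_left e hl0]
          have he0 : e ≠ 0 := by rintro rfl; simp at hk0
          by_cases hep : IsPrimePow e
          · refine mul_le_mul_of_nonneg_right ?_ ArithmeticFunction.vonMangoldt_nonneg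
            by_cases hco : (l * e).Coprime P
            · have hl' : l.Coprime P := hco.coprime_dvd_left (Dvd.intro e rfl)
              simp only [f, if_pos hco, if_pos hl']
              calc _ ≤ (l : ℝ) / l.totient * (e / e.totient) :=
                    self_div_totient_mul_le l e hl0.ne' he0
                _ ≤ (l : ℝ) / l.totient * 2 := by
                    gcongr; exact self_div_totient_le_two_of_isPrimePow hep
                _ = _ := by ring
            · have : f (l * e) = 0 := if_neg hco
              rw [this]
              exact mul_nonneg (by norm_num) (hf0 l)
          · rw [ArithmeticFunction.vonMangoldt_eq_zero_iff.2 hep]; simp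
      _ = ∑ l ∈ Finset.Ioc 0 N, ∑ e ∈ Finset.Ioc 0 (N / l),
            2 * f l * ArithmeticFunction.vonMangoldt e := hswap
      _ ≤ ∑ l ∈ Finset.Ioc 0 N, 2 * A * N * (f l / l) := by
          refine Finset.sum_le_sum fun l hl => ?_
          have hl0 : (0 : ℝ) < l := by exact_mod_cast (Finset.mem_Ioc.1 hl).1
          rw [← Finset.mul_sum]
          have hpsi : ∑ e ∈ Finset.Ioc 0 (N / l), ArithmeticFunction.vonMangoldt e ≤
              A * ((N : ℝ) / l) := by
            have := Chebyshev.psi_le_const_mul_self (x := (N : ℝ) / l) (by positivity)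
            rwa [Chebyshev.psi, Nat.floor_div_natCast, Nat.floor_natCast] at this
          calc _ ≤ 2 * f l * (A * ((N : ℝ) / l)) :=
                mul_le_mul_of_nonneg_left hpsi (mul_nonneg (by norm_num) (hf0 l))
            _ = _ := by ring
      _ = _ := by rw [Finset.mul_sum]
  -- The deficit `log (N / k)` is at most `N / k`, again producing `f k / k`.
  have hlogNk : ∑ k ∈ Finset.Ioc 0 N, f k * (Real.log N - Real.log k) ≤
      N * ∑ l ∈ Finset.Ioc 0 N, f l / l := by
    rw [Finset.mul_sum]
    refine Finset.sum_le_sum fun k hk => ?_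
    have hk0 : (0 : ℝ) < k := by exact_mod_cast (Finset.mem_Ioc.1 hk).1
    rw [← Real.log_div hNpos.ne' hk0.ne']
    have : Real.log ((N : ℝ) / k) ≤ N / k := by
      have := Real.log_le_sub_one_of_pos (show (0 : ℝ) < N / k by positivity)
      linarith
    calc _ ≤ f k * (N / k) := mul_le_mul_of_nonneg_left this (hf0 k)
      _ = _ := by ring
  have hsum : Real.log N * ∑ k ∈ Finset.Ioc 0 N, f k ≤
      (2 * A + 1) * N * ∑ l ∈ Finset.Ioc 0 N, f l / l := by
    have e : Real.log N * ∑ k ∈ Finset.Ioc 0 N, f k =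
        ∑ k ∈ Finset.Ioc 0 N, f k * Real.log k +
          ∑ k ∈ Finset.Ioc 0 N, f k * (Real.log N - Real.log k) := by
      rw [← Finset.sum_add_distrib, Finset.mul_sum]
      exact Finset.sum_congr rfl fun k _ => by ring
    rw [e]
    calc _ ≤ _ := add_le_add hlogk hlogNk
      _ = _ := by ring
  rw [Finset.sum_filter]
  refine le_of_mul_le_mul_left ?_ hlogN
  calc _ ≤ _ := hsum
    _ ≤ (2 * A + 1) * N * (C * Real.log N * ((P.totient : ℝ) / P)) := by
        rw [hfs]
        exact mul_le_mul_of_nonneg_left (h N P hN hP hPN) (by positivity)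
    _ = _ := by ring

/-! ### Counting pairs of units along a line modulo `d`. -/

/-- All fibres are cosets of the kernel. Used for the reduction from `p ^ k` to `p`, which detects
units. -/
theorem AddMonoidHom.card_preimage_mul_card {G H : Type*} [AddGroup G] [AddGroup H] [Finite G]
    [Finite H] (f : G →+ H) (hf : Function.Surjective f) (S : Set H) :
    Nat.card {g // f g ∈ S} * Nat.card H = Nat.card S * Nat.card G := by
  classical
  have := Fintype.ofFinite H
  have hfib : ∀ h : H, Nat.card {g // f g = h} = Nat.card {g // f g = 0} := by
    intro h
    obtain ⟨g₀, rfl⟩ := hf h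
    refine Nat.card_congr ((Equiv.addRight (-g₀)).subtypeEquiv fun g => ?_)
    simp [add_neg_eq_zero]
  have h1 : ∀ S : Set H, Nat.card {g // f g ∈ S} = Nat.card S * Nat.card {g // f g = 0} := by
    intro S
    have e : {g // f g ∈ S} ≃ Σ s : S, {g // f g = s.1} :=
      { toFun := fun g => ⟨⟨f g.1, g.2⟩, ⟨g.1, rfl⟩⟩
        invFun := fun x => ⟨x.2.1, by rw [x.2.2]; exact x.1.2⟩
        left_inv := fun g => rfl
        right_inv := fun ⟨⟨s, hs⟩, ⟨g, (hg : f g = s)⟩⟩ => by subst hg; rfl }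
    rw [Nat.card_congr e, Nat.card_sigma]
    simp only [hfib, Finset.sum_const, smul_eq_mul, Finset.card_univ, ← Nat.card_eq_fintype_card]
  have h2 : Nat.card G = Nat.card H * Nat.card {g // f g = 0} := by
    have := h1 Set.univ
    rw [Nat.card_congr (Equiv.Set.univ H)] at this
    rw [← this]
    exact Nat.card_congr (Equiv.subtypeUnivEquiv fun _ => Set.mem_univ _).symm
  rw [h1 S, h2]
  ring

/-- The number of residues `t` modulo `d` for which `a + t m` and `b + t n` are both units. -/
noncomputable def unitPairCount (a m b n : ℤ) (d : ℕ) : ℕ :=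
  Nat.card {t : ZMod d // IsUnit ((a : ZMod d) + t * m) ∧ IsUnit ((b : ZMod d) + t * n)}

theorem unitPairCount_mul (a m b n : ℤ) {d e : ℕ} (h : d.Coprime e) :
    unitPairCount a m b n (d * e) = unitPairCount a m b n d * unitPairCount a m b n e := by
  unfold unitPairCount
  rw [← Nat.card_prod]
  refine Nat.card_congr (Equiv.trans ((ZMod.chineseRemainder h).toEquiv.subtypeEquiv
    (q := fun x : ZMod d × ZMod e =>
      (IsUnit ((a : ZMod d) + x.1 * m) ∧ IsUnit ((b : ZMod d) + x.1 * n)) ∧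
      (IsUnit ((a : ZMod e) + x.2 * m) ∧ IsUnit ((b : ZMod e) + x.2 * n))) fun t => ?_)
    (Equiv.subtypeProdEquivProd
      (p := fun t : ZMod d => IsUnit ((a : ZMod d) + t * m) ∧ IsUnit ((b : ZMod d) + t * n))
      (q := fun t : ZMod e => IsUnit ((a : ZMod e) + t * m) ∧ IsUnit ((b : ZMod e) + t * n))))
  have key : ∀ u v : ℤ, IsUnit ((u : ZMod (d * e)) + t * v) ↔
      IsUnit ((u : ZMod d) + (ZMod.chineseRemainder h t).1 * v) ∧
      IsUnit ((u : ZMod e) + (ZMod.chineseRemainder h t).2 * v) := by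
    intro u v
    rw [← isUnit_map_iff (ZMod.chineseRemainder h), Prod.isUnit_iff]
    simp
  rw [key, key]
  tauto

theorem unitPairCount_one (a m b n : ℤ) : unitPairCount a m b n 1 = 1 := by
  unfold unitPairCount
  rw [Nat.card_eq_one_iff_unique]
  refine ⟨inferInstance, ⟨⟨0, ?_, ?_⟩⟩⟩ <;> exact isUnit_of_subsingleton _

theorem ZMod.isUnit_castHom_prime_iff {p k : ℕ} [Fact p.Prime] (hk : k ≠ 0) (x : ZMod (p ^ k)) :
    IsUnit x ↔ IsUnit (ZMod.castHom (dvd_pow_self p hk) (ZMod p) x) := by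
  have : NeZero (p ^ k) := ⟨pow_ne_zero _ (Fact.out : p.Prime).ne_zero⟩
  obtain ⟨y, rfl⟩ := ZMod.natCast_zmod_surjective x
  rw [map_natCast, ZMod.isUnit_iff_coprime, ZMod.isUnit_iff_coprime]
  exact Nat.coprime_pow_right_iff (Nat.pos_of_ne_zero hk) y p

theorem unitPairCount_prime_pow (a m b n : ℤ) {p k : ℕ} (hp : p.Prime) (hk : k ≠ 0) :
    unitPairCount a m b n (p ^ k) * p = unitPairCount a m b n p * p ^ k := by
  have := Fact.mk hp
  have : NeZero (p ^ k) := ⟨pow_ne_zero _ hp.ne_zero⟩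
  have h := AddMonoidHom.card_preimage_mul_card
    (ZMod.castHom (dvd_pow_self p hk) (ZMod p)).toAddMonoidHom
    (ZMod.castHom_surjective (dvd_pow_self p hk))
    {t | IsUnit ((a : ZMod p) + t * m) ∧ IsUnit ((b : ZMod p) + t * n)}
  rw [Nat.card_zmod, Nat.card_zmod] at h
  rw [unitPairCount, unitPairCount]
  refine Eq.trans (congrArg (· * p) (Nat.card_congr (Equiv.subtypeEquivRight fun t => ?_))) h
  rw [ZMod.isUnit_castHom_prime_iff hk, ZMod.isUnit_castHom_prime_iff hk]
  simp only [map_add, map_mul, map_intCast]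
  exact Iff.rfl

theorem unitPairCount_le_prod (a m b n : ℤ) (c : ℕ → ℝ) (hc : ∀ p, p.Prime → 0 ≤ c p)
    (h : ∀ p, p.Prime → (unitPairCount a m b n p : ℝ) ≤ p * c p) {d : ℕ} (hd : d ≠ 0) :
    (unitPairCount a m b n d : ℝ) ≤ d * ∏ p ∈ d.primeFactors, c p := by
  induction d using Nat.recOnPosPrimePosCoprime with
  | zero => exact absurd rfl hd
  | one => simp [unitPairCount_one]
  | prime_pow p k hp hk =>
    have h1 := unitPairCount_prime_pow a m b n hp hk.ne'
    rw [Nat.primeFactors_prime_pow hk.ne' hp, Finset.prod_singleton]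
    have hp0 : (0 : ℝ) < p := by exact_mod_cast hp.pos
    refine le_of_mul_le_mul_right ?_ hp0
    have h2 : (unitPairCount a m b n (p ^ k) : ℝ) * p = unitPairCount a m b n p * (p : ℝ) ^ k := by
      exact_mod_cast h1
    rw [h2]
    calc _ ≤ (p * c p) * (p : ℝ) ^ k := mul_le_mul_of_nonneg_right (h p hp) (by positivity)
      _ = _ := by push_cast; ring
  | coprime x y hx hy hxy ihx ihy =>
    rw [unitPairCount_mul a m b n hxy, hxy.primeFactors_mul,
      Finset.prod_union hxy.disjoint_primeFactors]
    push_cast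
    calc _ ≤ (x * ∏ p ∈ x.primeFactors, c p) * (y * ∏ p ∈ y.primeFactors, c p) := by
          refine mul_le_mul (ihx (by omega)) (ihy (by omega)) (Nat.cast_nonneg _) ?_
          exact mul_nonneg (Nat.cast_nonneg _) (Finset.prod_nonneg fun p hp =>
            hc p (Nat.prime_of_mem_primeFactors hp))
      _ = _ := by ring

theorem add_neg_div_mul_self {p : ℕ} [Fact p.Prime] {a m : ZMod p} (hm : m ≠ 0) :
    a + (-a / m) * m = 0 := by
  rw [div_mul_cancel₀ _ hm]; ring

/-- The excluded residues are `-a / m` and `-b / n`. At least one exists since `p` cannot divide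
both `m` and `n`; if `p` divides none of `m`, `n`, `k`, both exist and differ, because `a n - b m =
k` is nonzero modulo `p`. -/
theorem unitPairCount_prime_le (a b k : ℤ) (m n : ℕ) (hmn : m.Coprime n) (hk : a * n - b * m = k)
    {p : ℕ} (hp : p.Prime) :
    (unitPairCount a m b n p : ℝ) ≤ p * (if (p : ℤ) ∣ m * n * k then 1 - (p : ℝ)⁻¹
      else (1 - (p : ℝ)⁻¹) ^ 2) := by
  have := Fact.mk hp
  have hp0 : (0 : ℝ) < p := by exact_mod_cast hp.pos
  have hcard : unitPairCount a m b n p =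
      (Finset.univ.filter fun t : ZMod p =>
        IsUnit ((a : ZMod p) + t * (m : ℤ)) ∧ IsUnit ((b : ZMod p) + t * (n : ℤ))).card := by
    rw [unitPairCount, Nat.card_eq_fintype_card, Fintype.card_subtype]
  have hle : ∀ S : Finset (ZMod p),
      (∀ t ∈ S, ¬ (IsUnit ((a : ZMod p) + t * (m : ℤ)) ∧ IsUnit ((b : ZMod p) + t * (n : ℤ)))) →
      (unitPairCount a m b n p : ℝ) ≤ p - S.card := by
    intro S hS
    have h1 : (Finset.univ.filter fun t : ZMod p =>
        IsUnit ((a : ZMod p) + t * (m : ℤ)) ∧ IsUnit ((b : ZMod p) + t * (n : ℤ))) ⊆ Sᶜ := by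
      intro t ht
      rw [Finset.mem_compl]
      exact fun hts => hS t hts (Finset.mem_filter.1 ht).2
    have h2 := Finset.card_le_card h1
    rw [Finset.card_compl, ZMod.card, ← hcard] at h2
    have h3 : S.card ≤ p := by
      have := Finset.card_le_univ S
      rwa [ZMod.card] at this
    rw [le_sub_iff_add_le]
    exact_mod_cast (by omega : unitPairCount a m b n p + S.card ≤ p)
  split_ifs with hdvd
  · have e : (p : ℝ) * (1 - (p : ℝ)⁻¹) = p - ((1 : ℕ) : ℝ) := by push_cast; field_simp
    rw [e]
    by_cases hm : ((m : ℤ) : ZMod p) = 0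
    · have hn : ((n : ℤ) : ZMod p) ≠ 0 := by
        intro hn
        rw [ZMod.intCast_zmod_eq_zero_iff_dvd] at hm hn
        exact hp.one_lt.ne' (Nat.eq_one_of_dvd_coprimes hmn (by exact_mod_cast hm)
          (by exact_mod_cast hn))
      refine hle {-(b : ZMod p) / (n : ℤ)} fun t ht h => ?_
      rw [Finset.mem_singleton] at ht
      rw [ht, add_neg_div_mul_self hn] at h
      exact not_isUnit_zero h.2
    · refine hle {-(a : ZMod p) / (m : ℤ)} fun t ht h => ?_
      rw [Finset.mem_singleton] at ht
      rw [ht, add_neg_div_mul_self hm] at h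
      exact not_isUnit_zero h.1
  · have hne : (((m : ℤ) * n * k : ℤ) : ZMod p) ≠ 0 := by
      rwa [Ne, ZMod.intCast_zmod_eq_zero_iff_dvd]
    push_cast at hne
    have hm : ((m : ℤ) : ZMod p) ≠ 0 := by
      intro h; apply hne; push_cast at h; rw [h]; ring
    have hn : ((n : ℤ) : ZMod p) ≠ 0 := by
      intro h; apply hne; push_cast at h; rw [h]; ring
    have hk0 : (k : ZMod p) ≠ 0 := by
      intro h; apply hne; rw [h]; ring
    have hneq : -(a : ZMod p) / (m : ℤ) ≠ -(b : ZMod p) / (n : ℤ) := by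
      intro h
      rw [div_eq_div_iff hm hn] at h
      apply hk0
      rw [← hk]
      push_cast at h ⊢
      linear_combination -h
    have h2 := hle {-(a : ZMod p) / (m : ℤ), -(b : ZMod p) / (n : ℤ)} fun t ht h => by
      rw [Finset.mem_insert, Finset.mem_singleton] at ht
      rcases ht with ht | ht
      · rw [ht, add_neg_div_mul_self hm] at h
        exact not_isUnit_zero h.1
      · rw [ht, add_neg_div_mul_self hn] at h
        exact not_isUnit_zero h.2
    rw [Finset.card_pair hneq] at h2
    refine h2.trans ?_
    have : (p : ℝ) * (1 - (p : ℝ)⁻¹) ^ 2 = p - 2 + (p : ℝ)⁻¹ := by field_simp; ring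
    rw [this]
    have : 0 < (p : ℝ)⁻¹ := by positivity
    push_cast
    linarith

theorem prod_primeFactors_eq_prod_ite {A M : ℕ} (hA : A ∣ M) (hM : M ≠ 0) (g : ℕ → ℝ) :
    ∏ p ∈ A.primeFactors, g p = ∏ p ∈ M.primeFactors, if p ∣ A then g p else 1 := by
  rw [← Finset.prod_filter]
  refine Finset.prod_congr ?_ fun _ _ => rfl
  ext p
  simp only [Finset.mem_filter, Nat.mem_primeFactors]
  constructor
  · rintro ⟨h1, h2, -⟩; exact ⟨⟨h1, h2.trans hA, hM⟩, h2⟩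
  · rintro ⟨⟨h1, -, -⟩, h2⟩; exact ⟨h1, h2, ne_zero_of_dvd_ne_zero hM hA⟩

/-- With all products taken over the primes of `d m n k`, this is a comparison of powers of `u = 1 -
1 / p` prime by prime. The only loss is at primes dividing `k` but not `d`. -/
theorem prod_local_factor_mul_le {d m n k : ℕ} (hd : d ≠ 0) (hm : m ≠ 0) (hn : n ≠ 0) (hk : k ≠ 0)
    (hmn : m.Coprime n) (hkmn : k.Coprime (m * n)) :
    (∏ p ∈ d.primeFactors, if p ∣ m * n * k then 1 - (p : ℝ)⁻¹ else (1 - (p : ℝ)⁻¹) ^ 2) *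
      ((((m * n : ℕ).totient : ℝ) / (m * n : ℕ)) * ((k.totient : ℝ) / k)) ≤
    (((d * m : ℕ).totient : ℝ) / (d * m : ℕ)) * (((d * n : ℕ).totient : ℝ) / (d * n : ℕ)) := by
  have hM : d * m * n * k ≠ 0 := by positivity
  rw [totient_div_eq_prod (mul_ne_zero hm hn), totient_div_eq_prod hk,
    totient_div_eq_prod (mul_ne_zero hd hm), totient_div_eq_prod (mul_ne_zero hd hn),
    prod_primeFactors_eq_prod_ite (M := d * m * n * k) (A := d) ⟨m * n * k, by ring⟩ hM,
    prod_primeFactors_eq_prod_ite (M := d * m * n * k) (A := m * n) ⟨d * k, by ring⟩ hM,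
    prod_primeFactors_eq_prod_ite (M := d * m * n * k) (A := k) ⟨d * m * n, by ring⟩ hM,
    prod_primeFactors_eq_prod_ite (M := d * m * n * k) (A := d * m) ⟨n * k, by ring⟩ hM,
    prod_primeFactors_eq_prod_ite (M := d * m * n * k) (A := d * n) ⟨m * k, by ring⟩ hM,
    ← Finset.prod_mul_distrib, ← Finset.prod_mul_distrib, ← Finset.prod_mul_distrib]
  refine Finset.prod_le_prod (fun p hp => ?_) fun p hp => ?_
  · have hu := one_sub_inv_prime_pos (Nat.prime_of_mem_primeFactors hp)
    split_ifs <;> positivity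
  · have hpp := Nat.prime_of_mem_primeFactors hp
    have hu := one_sub_inv_prime_pos hpp
    have hu1 : 1 - (p : ℝ)⁻¹ ≤ 1 := by
      have : 0 < (p : ℝ)⁻¹ := by have := hpp.pos; positivity
      linarith
    have h1 : ¬ (p ∣ m ∧ p ∣ n) := fun h =>
      hpp.one_lt.ne' (Nat.eq_one_of_dvd_coprimes hmn h.1 h.2)
    have h2 : ¬ (p ∣ k ∧ p ∣ m * n) := fun h =>
      hpp.one_lt.ne' (Nat.eq_one_of_dvd_coprimes hkmn h.1 h.2)
    simp only [hpp.dvd_mul] at h2 ⊢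
    generalize 1 - (p : ℝ)⁻¹ = u at hu hu1
    by_cases hd : p ∣ d <;> by_cases hm : p ∣ m <;> by_cases hn : p ∣ n <;>
      by_cases hk : p ∣ k <;> (simp_all; try nlinarith)

/-! ### Counting pairs of shifted fractions that are close. -/

/-- The integers `a` coprime to `q` for which `(a + γ) / q` lies in `[-1, 2]`. -/
noncomputable def coprimeNumerators (γ : ℝ) (q : ℕ) : Finset ℤ :=
  (Finset.Icc ⌈-(q : ℝ) - γ⌉ ⌊2 * (q : ℝ) - γ⌋).filter fun a => Int.gcd a q = 1

theorem mem_coprimeNumerators {γ : ℝ} {q : ℕ} {a : ℤ} :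
    a ∈ coprimeNumerators γ q ↔
      (-(q : ℝ) - γ ≤ a ∧ (a : ℝ) ≤ 2 * q - γ) ∧ Int.gcd a q = 1 := by
  rw [coprimeNumerators, Finset.mem_filter, Finset.mem_Icc, Int.ceil_le, Int.le_floor]

theorem isUnit_intCast_zmod_of_gcd_eq_one {a : ℤ} {d m : ℕ}
    (h : Int.gcd a ((d * m : ℕ) : ℤ) = 1) : IsUnit (a : ZMod d) := by
  rw [ZMod.coe_int_isUnit_iff_isCoprime]
  have h1 : IsCoprime a ((d * m : ℕ) : ℤ) := Int.isCoprime_iff_gcd_eq_one.2 h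
  push_cast at h1
  exact (IsCoprime.of_mul_right_left h1).symm

/-- The solutions are `(a₀ + t m, b₀ + t n)`, and coprimality forces both coordinates to be units
modulo `d`. As `a` and `a₀` lie in a common interval of length `3 d m`, one has `|t| ≤ 3 d`, so `t`
meets at most seven blocks of length `d`. -/
theorem card_pairs_le_unitPairCount (γ : ℝ) {d m n : ℕ} (hd : d ≠ 0) (hm : m ≠ 0) (hn : n ≠ 0)
    (hmn : m.Coprime n) (k a₀ b₀ : ℤ) (ha₀ : a₀ ∈ coprimeNumerators γ (d * m))
    (hk₀ : a₀ * n - b₀ * m = k) :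
    ((coprimeNumerators γ (d * m) ×ˢ coprimeNumerators γ (d * n)).filter
      fun x => x.1 * n - x.2 * m = k).card ≤ unitPairCount a₀ m b₀ n d * 7 := by
  classical
  have : NeZero d := ⟨hd⟩
  have hd' : (0 : ℤ) < d := by exact_mod_cast Nat.pos_of_ne_zero hd
  have hm' : (m : ℤ) ≠ 0 := by exact_mod_cast hm
  have hmpos : (0 : ℝ) < m := by exact_mod_cast Nat.pos_of_ne_zero hm
  have hn' : (n : ℤ) ≠ 0 := by exact_mod_cast hn
  have hpar : ∀ x ∈ (coprimeNumerators γ (d * m) ×ˢ coprimeNumerators γ (d * n)).filter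
      (fun x => x.1 * n - x.2 * m = k), ∃ t : ℤ, x.1 = a₀ + t * m ∧ x.2 = b₀ + t * n := by
    intro x hx
    have hxk := (Finset.mem_filter.1 hx).2
    have hco : IsCoprime (m : ℤ) (n : ℤ) := Nat.isCoprime_iff_coprime.2 hmn
    have hdvd : (m : ℤ) ∣ (x.1 - a₀) * n := ⟨x.2 - b₀, by linear_combination hxk - hk₀⟩
    obtain ⟨t, ht⟩ := hco.dvd_of_dvd_mul_right hdvd
    refine ⟨t, by linear_combination ht, ?_⟩
    have : (m : ℤ) * (x.2 - b₀) = m * (t * n) := by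
      linear_combination hk₀ - hxk + n * ht
    have := mul_left_cancel₀ hm' this
    linear_combination this
  have hquot : ∀ (x : ℤ × ℤ) (t : ℤ), x.1 = a₀ + t * m → (x.1 - a₀) / m = t := by
    intro x t h
    rw [h, add_sub_cancel_left, Int.mul_ediv_cancel _ hm']
  have hU : unitPairCount a₀ m b₀ n d * 7 =
      ((Finset.univ.filter fun t : ZMod d =>
        IsUnit ((a₀ : ZMod d) + t * (m : ℤ)) ∧ IsUnit ((b₀ : ZMod d) + t * (n : ℤ))) ×ˢ
        Finset.Ico (-3 : ℤ) 4).card := by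
    rw [Finset.card_product, unitPairCount, Nat.card_eq_fintype_card, Fintype.card_subtype]
    simp
  rw [hU]
  -- Here `(x.1 - a₀) / m` is `t`, recorded by its residue and its quotient modulo `d`.
  refine Finset.card_le_card_of_injOn
    (fun x => ((((x.1 - a₀) / m : ℤ) : ZMod d), (x.1 - a₀) / m / d)) ?_ ?_
  · intro x hx
    obtain ⟨t, h1, h2⟩ := hpar x hx
    obtain ⟨hx1, -⟩ := Finset.mem_filter.1 hx
    rw [Finset.mem_product] at hx1
    simp only [hquot x t h1, Finset.coe_product, Set.mem_prod, Finset.mem_coe, Finset.mem_filter,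
      Finset.mem_univ, true_and, Finset.mem_Ico]
    obtain ⟨⟨hl, hr⟩, hg⟩ := mem_coprimeNumerators.1 hx1.1
    obtain ⟨⟨hl₀, hr₀⟩, -⟩ := mem_coprimeNumerators.1 ha₀
    have hg2 := (mem_coprimeNumerators.1 hx1.2).2
    refine ⟨⟨?_, ?_⟩, ?_, ?_⟩
    · have := isUnit_intCast_zmod_of_gcd_eq_one hg
      rw [h1] at this
      push_cast at this ⊢
      exact this
    · have := isUnit_intCast_zmod_of_gcd_eq_one hg2
      rw [h2] at this
      push_cast at this ⊢
      exact this
    · rw [Int.le_ediv_iff_mul_le hd']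
      have h1' : (x.1 : ℝ) = a₀ + t * m := by exact_mod_cast h1
      push_cast at hl hr₀
      have : (-3 * d : ℝ) * m ≤ t * m := by nlinarith
      have := le_of_mul_le_mul_right this hmpos
      exact_mod_cast this
    · rw [Int.ediv_lt_iff_lt_mul hd']
      have h1' : (x.1 : ℝ) = a₀ + t * m := by exact_mod_cast h1
      push_cast at hr hl₀
      have : (t : ℝ) * m ≤ (3 * d : ℝ) * m := by nlinarith
      have := le_of_mul_le_mul_right this hmpos
      have : t ≤ 3 * d := by exact_mod_cast this
      linarith
  · intro x hx y hy hxy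
    obtain ⟨t, h1, h2⟩ := hpar x hx
    obtain ⟨u, h3, h4⟩ := hpar y hy
    simp only [hquot x t h1, hquot y u h3, Prod.mk.injEq] at hxy
    obtain ⟨he, hq⟩ := hxy
    rw [ZMod.intCast_eq_intCast_iff'] at he
    have htu : t = u := by
      rw [← Int.mul_ediv_add_emod t d, ← Int.mul_ediv_add_emod u d, he, hq]
    rw [htu] at h1 h2
    exact Prod.ext (h1.trans h3.symm) (h2.trans h4.symm)

theorem card_pairs_le (γ : ℝ) {d m n : ℕ} (hd : d ≠ 0) (hm : m ≠ 0) (hn : n ≠ 0)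
    (hmn : m.Coprime n) {k : ℤ} (hk : k ≠ 0) (hkmn : k.natAbs.Coprime (m * n)) :
    (((coprimeNumerators γ (d * m) ×ˢ coprimeNumerators γ (d * n)).filter
      fun x => x.1 * n - x.2 * m = k).card : ℝ) * (((m * n : ℕ).totient : ℝ) / (m * n : ℕ)) ≤
    7 * d * ((((d * m : ℕ).totient : ℝ) / (d * m : ℕ)) * (((d * n : ℕ).totient : ℝ) / (d * n : ℕ)))
      * ((k.natAbs : ℝ) / k.natAbs.totient) := by
  set S := (coprimeNumerators γ (d * m) ×ˢ coprimeNumerators γ (d * n)).filter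
      fun x => x.1 * n - x.2 * m = k with hS
  rcases S.eq_empty_or_nonempty with h0 | ⟨⟨a₀, b₀⟩, h0⟩
  · rw [h0]
    simp only [Finset.card_empty, Nat.cast_zero, zero_mul]
    positivity
  rw [hS, Finset.mem_filter, Finset.mem_product] at h0
  have h1 := card_pairs_le_unitPairCount γ hd hm hn hmn k a₀ b₀ h0.1.1 h0.2
  rw [← hS] at h1
  have h2 := unitPairCount_le_prod a₀ m b₀ n
    (fun p => if (p : ℤ) ∣ m * n * k then 1 - (p : ℝ)⁻¹ else (1 - (p : ℝ)⁻¹) ^ 2)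
    (fun p hp => by have := one_sub_inv_prime_pos hp; split_ifs <;> positivity)
    (fun p hp => unitPairCount_prime_le a₀ b₀ k m n hmn h0.2 hp) hd
  have hkn : k.natAbs ≠ 0 := Int.natAbs_ne_zero.2 hk
  have h3 := prod_local_factor_mul_le hd hm hn hkn hmn hkmn
  have hiff : ∀ p : ℕ, (p : ℤ) ∣ m * n * k ↔ p ∣ m * n * k.natAbs := by
    intro p
    rw [Int.natCast_dvd, Int.natAbs_mul]
    norm_cast
  simp only [hiff] at h2
  set Q := ∏ p ∈ d.primeFactors,
    if p ∣ m * n * k.natAbs then 1 - (p : ℝ)⁻¹ else (1 - (p : ℝ)⁻¹) ^ 2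
  have hkt : (0 : ℝ) < k.natAbs.totient := by
    exact_mod_cast Nat.totient_pos.2 (Nat.pos_of_ne_zero hkn)
  have hk' : (0 : ℝ) < k.natAbs := by exact_mod_cast Nat.pos_of_ne_zero hkn
  have h1' : (S.card : ℝ) ≤ unitPairCount a₀ m b₀ n d * 7 := by exact_mod_cast h1
  set V := ((m * n : ℕ).totient : ℝ) / (m * n : ℕ) with hV
  have hV0 : 0 ≤ V := by positivity
  calc (S.card : ℝ) * V ≤ (d * Q * 7) * V := by
        gcongr
        exact h1'.trans (by gcongr)
    _ = 7 * d * (Q * (V * ((k.natAbs.totient : ℝ) / k.natAbs))) *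
          ((k.natAbs : ℝ) / k.natAbs.totient) := by
        field_simp
    _ ≤ _ := by gcongr

theorem sum_natAbs_le_two_mul_sum (N : ℕ) (P : ℕ) (g : ℕ → ℝ) (hg : ∀ j, 0 ≤ g j) :
    ∑ k ∈ Finset.Icc (-(N : ℤ)) N with k ≠ 0 ∧ k.natAbs.Coprime P, g k.natAbs ≤
      2 * ∑ j ∈ Finset.Ioc 0 N with j.Coprime P, g j := by
  set K := (Finset.Icc (-(N : ℤ)) N).filter fun k => k ≠ 0 ∧ k.natAbs.Coprime P with hK
  have hmaps : ∀ k ∈ K, k.natAbs ∈ (Finset.Ioc 0 N).filter fun j => j.Coprime P := by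
    intro k hk
    rw [hK, Finset.mem_filter, Finset.mem_Icc] at hk
    rw [Finset.mem_filter, Finset.mem_Ioc]
    exact ⟨by omega, hk.2.2⟩
  rw [← Finset.sum_fiberwise_of_maps_to hmaps, Finset.mul_sum]
  refine Finset.sum_le_sum fun j _ => ?_
  have h1 : ∑ k ∈ K with k.natAbs = j, g k.natAbs = ∑ k ∈ K with k.natAbs = j, g j :=
    Finset.sum_congr rfl fun k hk => by rw [(Finset.mem_filter.1 hk).2]
  rw [h1, Finset.sum_const, nsmul_eq_mul]
  refine mul_le_mul_of_nonneg_right ?_ (hg j)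
  have h2 : K.filter (fun k => k.natAbs = j) ⊆ {(j : ℤ), -(j : ℤ)} := by
    intro k hk
    have := (Finset.mem_filter.1 hk).2
    rw [Finset.mem_insert, Finset.mem_singleton]
    omega
  exact_mod_cast (Finset.card_le_card h2).trans Finset.card_le_two

/-- Modulo `m` the number is `a n`, modulo `n` it is `-b m`, and all these factors are units. -/
theorem natAbs_coprime_of_gcd_eq_one {a b : ℤ} {d m n : ℕ} (hmn : m.Coprime n)
    (ha : Int.gcd a ((d * m : ℕ) : ℤ) = 1) (hb : Int.gcd b ((d * n : ℕ) : ℤ) = 1) :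
    (a * n - b * m).natAbs.Coprime (m * n) := by
  have ha' : IsCoprime a (m : ℤ) := by
    have h : IsCoprime a ((d * m : ℕ) : ℤ) := Int.isCoprime_iff_gcd_eq_one.2 ha
    push_cast at h
    exact IsCoprime.of_mul_right_right h
  have hb' : IsCoprime b (n : ℤ) := by
    have h : IsCoprime b ((d * n : ℕ) : ℤ) := Int.isCoprime_iff_gcd_eq_one.2 hb
    push_cast at h
    exact IsCoprime.of_mul_right_right h
  have hco : IsCoprime (m : ℤ) (n : ℤ) := Nat.isCoprime_iff_coprime.2 hmn
  have h1 : IsCoprime (a * n - b * m) (m : ℤ) := by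
    have := (ha'.mul_left hco.symm).add_mul_right_left (-b)
    rwa [neg_mul, ← sub_eq_add_neg] at this
  have h2 : IsCoprime (a * n - b * m) (n : ℤ) := by
    have := ((hb'.mul_left hco).neg_left).add_mul_right_left a
    rwa [neg_add_eq_sub] at this
  have h3 := h1.mul_right h2
  have h4 := Int.isCoprime_iff_gcd_eq_one.1 h3
  rw [Int.gcd_def, Int.natAbs_mul] at h4
  simpa using h4

/-- Group the pairs by `k = a n - b m`, which is nonzero and coprime to `m n`. The loss `mn / φ(mn)`
in each fibre cancels against the sieve saving in the sum of `k / φ(k)`. -/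
theorem exists_card_close_pairs_le (γ : ℝ) {δ : ℝ} (hδ : 0 < δ) :
    ∃ C : ℝ, 0 < C ∧ ∀ (q r : ℕ) (s t : ℝ), q ≠ 0 → r ≠ 0 → δ ≤ s → δ ≤ t →
      (((coprimeNumerators γ q ×ˢ coprimeNumerators γ r).filter fun x =>
        x.1 * (r : ℤ) ≠ x.2 * (q : ℤ) ∧ |((x.1 : ℝ) + γ) * r - (x.2 + γ) * q| ≤ s * r + t * q).card : ℝ) ≤
      C * (s * r + t * q) * ((q.totient : ℝ) / q * ((r.totient : ℝ) / r)) := by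
  obtain ⟨C, hC, hsieve⟩ := exists_sum_coprime_self_div_totient_le
  -- Since `L ≥ δ (m + n)`, the part `1 + |γ| / δ` covers `|k| ≤ L + |γ| |n - m|`, and the extra `1
  -- / δ` gives `m + n ≤ N`, placing the primes of `m n` within the range of the sieve.
  set κ : ℝ := 1 + (|γ| + 1) / δ with hκ
  have hκ0 : 0 < κ := by positivity
  refine ⟨14 * C * κ, by positivity, fun q r s t hq hr hs ht => ?_⟩
  obtain ⟨d, m, n, hd, hmn, rfl, rfl⟩ : ∃ d m n : ℕ, d ≠ 0 ∧ m.Coprime n ∧ q = d * m ∧ r = d * n := by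
    obtain ⟨m, n, hmn, h1, h2⟩ := Nat.exists_coprime q r
    exact ⟨q.gcd r, m, n, Nat.gcd_ne_zero_left hq, hmn, by rw [mul_comm]; exact h1,
      by rw [mul_comm]; exact h2⟩
  have hm : m ≠ 0 := by rintro rfl; simp at hq
  have hn : n ≠ 0 := by rintro rfl; simp at hr
  have hdpos : (0 : ℝ) < d := by exact_mod_cast Nat.pos_of_ne_zero hd
  have hm1 : (1 : ℝ) ≤ m := by exact_mod_cast Nat.one_le_iff_ne_zero.2 hm
  have hn1 : (1 : ℝ) ≤ n := by exact_mod_cast Nat.one_le_iff_ne_zero.2 hn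
  set L : ℝ := s * n + t * m with hL
  have hLδ : δ * (m + n) ≤ L := by rw [hL]; nlinarith
  have hL0 : 0 < L := lt_of_lt_of_le (by positivity) hLδ
  set N : ℕ := ⌊κ * L⌋₊ with hN
  have hκL : (1 + |γ| / δ) * L + (m + n) ≤ κ * L := by
    have h1 : (m + n : ℝ) ≤ 1 / δ * L := by
      rw [one_div, inv_mul_eq_div, le_div_iff₀ hδ]; linarith
    have h2 : κ * L = (1 + |γ| / δ) * L + 1 / δ * L := by rw [hκ]; ring
    linarith
  have hγL : 0 ≤ (1 + |γ| / δ) * L := by positivity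
  have hmnN : m + n ≤ N := by
    rw [hN]
    refine Nat.le_floor ?_
    push_cast
    linarith
  have hNle : (N : ℝ) ≤ κ * L := Nat.floor_le (by positivity)
  have hmn0 : m * n ≠ 0 := mul_ne_zero hm hn
  have hs1 := hsieve N (m * n) (by omega) hmn0 (by
    intro p hp
    rw [Nat.mem_primeFactors] at hp
    rcases (hp.1.dvd_mul).1 hp.2.1 with h | h
    · exact (Nat.le_of_dvd (Nat.pos_of_ne_zero hm) h).trans (by omega)
    · exact (Nat.le_of_dvd (Nat.pos_of_ne_zero hn) h).trans (by omega))
  set S := (coprimeNumerators γ (d * m) ×ˢ coprimeNumerators γ (d * n)).filter fun x =>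
        x.1 * ((d * n : ℕ) : ℤ) ≠ x.2 * ((d * m : ℕ) : ℤ) ∧
          |((x.1 : ℝ) + γ) * (d * n : ℕ) - (x.2 + γ) * (d * m : ℕ)| ≤
            s * (d * n : ℕ) + t * (d * m : ℕ) with hS
  set K := (Finset.Icc (-(N : ℤ)) N).filter fun k => k ≠ 0 ∧ k.natAbs.Coprime (m * n) with hK
  have hmaps : ∀ x ∈ S, x.1 * n - x.2 * m ∈ K := by
    intro x hx
    rw [hS, Finset.mem_filter, Finset.mem_product] at hx
    obtain ⟨⟨hx1, hx2⟩, hne, hle⟩ := hx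
    rw [hK, Finset.mem_filter]
    refine ⟨?_, ?_, ?_⟩
    · have habs : |((x.1 * n - x.2 * m : ℤ) : ℝ)| ≤ κ * L := by
        have e : (((x.1 : ℝ) + γ) * (d * n : ℕ) - (x.2 + γ) * (d * m : ℕ)) =
            d * (((x.1 * n - x.2 * m : ℤ) : ℝ) + γ * (n - m)) := by push_cast; ring
        have e2 : s * (d * n : ℕ) + t * (d * m : ℕ) = d * L := by rw [hL]; push_cast; ring
        rw [e, e2, abs_mul, abs_of_pos hdpos] at hle
        have h1 := le_of_mul_le_mul_left hle hdpos
        have h2 : |γ * (n - m : ℝ)| ≤ |γ| / δ * L := by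
          rw [abs_mul]
          have h3 : |(n - m : ℝ)| ≤ m + n := by rw [abs_le]; constructor <;> linarith
          calc |γ| * |(n - m : ℝ)| ≤ |γ| * (L / δ) := by
                gcongr
                rw [le_div_iff₀ hδ]
                nlinarith
            _ = _ := by ring
        have h4 := abs_sub_abs_le_abs_sub (((x.1 * n - x.2 * m : ℤ) : ℝ)) (-(γ * (n - m : ℝ)))
        rw [abs_neg, sub_neg_eq_add] at h4
        linarith
      have hfl : |x.1 * n - x.2 * m| ≤ (N : ℤ) := by
        rw [hN, Int.abs_eq_natAbs]
        refine Int.ofNat_le.2 (Nat.le_floor ?_)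
        rw [Nat.cast_natAbs]
        push_cast at habs ⊢
        exact habs
      rw [Finset.mem_Icc]
      exact abs_le.1 hfl
    · intro h0
      apply hne
      push_cast
      linear_combination (d : ℤ) * h0
    · exact natAbs_coprime_of_gcd_eq_one hmn (mem_coprimeNumerators.1 hx1).2
        (mem_coprimeNumerators.1 hx2).2
  set Uq := (((d * m : ℕ).totient : ℝ) / (d * m : ℕ)) with hUq
  set Ur := (((d * n : ℕ).totient : ℝ) / (d * n : ℕ)) with hUr
  set V := ((m * n : ℕ).totient : ℝ) / (m * n : ℕ) with hV
  have hV0 : 0 < V := by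
    have : 0 < (m * n).totient := Nat.totient_pos.2 (Nat.pos_of_ne_zero hmn0)
    have : 0 < m * n := Nat.pos_of_ne_zero hmn0
    positivity
  have hUq0 : 0 ≤ Uq := by positivity
  have hUr0 : 0 ≤ Ur := by positivity
  refine le_of_mul_le_mul_right ?_ hV0
  calc (S.card : ℝ) * V
      = ∑ k ∈ K, ((S.filter fun x => x.1 * n - x.2 * m = k).card : ℝ) * V := by
        rw [Finset.card_eq_sum_card_fiberwise hmaps, ← Finset.sum_mul]
        push_cast
        rfl
    _ ≤ ∑ k ∈ K, 7 * d * (Uq * Ur) * ((k.natAbs : ℝ) / k.natAbs.totient) := by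
        refine Finset.sum_le_sum fun k hk => ?_
        rw [hK, Finset.mem_filter] at hk
        refine le_trans ?_ (card_pairs_le γ hd hm hn hmn hk.2.1 hk.2.2)
        refine mul_le_mul_of_nonneg_right ?_ hV0.le
        refine Nat.cast_le.2 (Finset.card_le_card (Finset.filter_subset_filter _ ?_))
        exact Finset.filter_subset _ _
    _ = 7 * d * (Uq * Ur) * ∑ k ∈ K, ((k.natAbs : ℝ) / k.natAbs.totient) := by
        rw [Finset.mul_sum]
    _ ≤ 7 * d * (Uq * Ur) * (2 * (C * (κ * L) * V)) := by
        refine mul_le_mul_of_nonneg_left ?_ (by positivity)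
        refine (sum_natAbs_le_two_mul_sum N (m * n) (fun j => (j : ℝ) / j.totient)
          fun j => by positivity).trans ?_
        refine mul_le_mul_of_nonneg_left (hs1.trans ?_) (by norm_num)
        gcongr
    _ = _ := by rw [hL]; push_cast; ring

/-! ### Reduced residues in intervals. -/

theorem abs_card_Icc_sub_le {x y : ℝ} (hxy : x ≤ y) :
    |((Finset.Icc ⌈x⌉ ⌊y⌋).card : ℝ) - (y - x)| ≤ 1 := by
  rw [Int.card_Icc]
  have h1 : ⌈x⌉ ≤ ⌊y⌋ + 1 := by
    rw [Int.ceil_le]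
    push_cast
    exact hxy.trans (Int.lt_floor_add_one y).le
  have h2 : (((⌊y⌋ + 1 - ⌈x⌉).toNat : ℕ) : ℝ) = (⌊y⌋ : ℝ) + 1 - ⌈x⌉ := by
    have : (((⌊y⌋ + 1 - ⌈x⌉).toNat : ℕ) : ℤ) = ⌊y⌋ + 1 - ⌈x⌉ := Int.toNat_of_nonneg (by omega)
    exact_mod_cast this
  rw [h2, abs_le]
  have := Int.floor_le y
  have := Int.lt_floor_add_one y
  have := Int.le_ceil x
  have := Int.ceil_lt_add_one x
  constructor <;> linarith

/-- The number of integers in `[x, y]` divisible by no element of a finite set of primes. -/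
theorem abs_card_sifted_sub_le (s : Finset ℕ) (hs : ∀ p ∈ s, p.Prime) :
    ∀ {x y : ℝ}, x ≤ y →
    |(((Finset.Icc ⌈x⌉ ⌊y⌋).filter fun a => ∀ p ∈ s, ¬ (p : ℤ) ∣ a).card : ℝ) -
      (y - x) * ∏ p ∈ s, (1 - (p : ℝ)⁻¹)| ≤ 2 ^ s.card := by
  classical
  induction s using Finset.induction_on with
  | empty =>
    intro x y hxy
    simpa using abs_card_Icc_sub_le hxy
  | insert p s hps ih =>
    intro x y hxy
    have hp : p.Prime := hs p (Finset.mem_insert_self p s)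
    have hs' : ∀ p ∈ s, p.Prime := fun r hr => hs r (Finset.mem_insert_of_mem hr)
    have hp0 : (0 : ℝ) < p := by exact_mod_cast hp.pos
    have hp0' : (p : ℤ) ≠ 0 := by exact_mod_cast hp.ne_zero
    have h1 := ih hs' hxy
    have h2 := ih hs' (div_le_div_of_nonneg_right hxy hp0.le : x / p ≤ y / p)
    -- Legendre's recursion: the integers removed by `p` are `p` times the integers of `[x / p, y /
    -- p]` that survive `s`. Each prime thus doubles the error.
    have hcount : ((Finset.Icc ⌈x⌉ ⌊y⌋).filter fun a => ∀ r ∈ s, ¬ (r : ℤ) ∣ a).card =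
        ((Finset.Icc ⌈x⌉ ⌊y⌋).filter fun a => ∀ r ∈ insert p s, ¬ (r : ℤ) ∣ a).card +
        ((Finset.Icc ⌈x / p⌉ ⌊y / p⌋).filter fun a => ∀ r ∈ s, ¬ (r : ℤ) ∣ a).card := by
      rw [← Finset.card_filter_add_card_filter_not (fun a : ℤ => ¬ (p : ℤ) ∣ a), Finset.filter_filter,
        Finset.filter_filter]
      congr 1
      · congr 1
        refine Finset.filter_congr fun a _ => ?_
        simp only [Finset.forall_mem_insert]
        tauto
      · symm
        refine Finset.card_bij (fun a _ => p * a) ?_ ?_ ?_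
        · intro a ha
          rw [Finset.mem_filter, Finset.mem_Icc, Int.ceil_le, Int.le_floor, div_le_iff₀ hp0,
            le_div_iff₀ hp0] at ha
          rw [Finset.mem_filter, Finset.mem_Icc, Int.ceil_le, Int.le_floor]
          push_cast
          refine ⟨⟨by linarith [ha.1.1], by linarith [ha.1.2]⟩, fun r hr hra => ?_,
            not_not.2 (Dvd.intro _ rfl)⟩
          have hco : IsCoprime (r : ℤ) (p : ℤ) := by
            rw [Nat.isCoprime_iff_coprime, Nat.coprime_primes (hs' r hr) hp]
            rintro rfl
            exact hps hr
          exact ha.2 r hr (hco.dvd_of_dvd_mul_left hra)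
        · intro a _ b _ hab
          exact mul_left_cancel₀ hp0' hab
        · intro b hb
          rw [Finset.mem_filter, Finset.mem_Icc, Int.ceil_le, Int.le_floor, not_not] at hb
          obtain ⟨⟨hb1, hb2⟩, hb3, ⟨a, rfl⟩⟩ := hb
          refine ⟨a, ?_, rfl⟩
          push_cast at hb1 hb2
          rw [Finset.mem_filter, Finset.mem_Icc, Int.ceil_le, Int.le_floor, div_le_iff₀ hp0,
            le_div_iff₀ hp0]
          exact ⟨⟨by linarith, by linarith⟩, fun r hr hra => hb3 r hr (hra.mul_left _)⟩
    have hcount' : (((Finset.Icc ⌈x⌉ ⌊y⌋).filter fun a => ∀ r ∈ s, ¬ (r : ℤ) ∣ a).card : ℝ) =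
        ((Finset.Icc ⌈x⌉ ⌊y⌋).filter fun a => ∀ r ∈ insert p s, ¬ (r : ℤ) ∣ a).card +
        ((Finset.Icc ⌈x / p⌉ ⌊y / p⌋).filter fun a => ∀ r ∈ s, ¬ (r : ℤ) ∣ a).card := by
      exact_mod_cast hcount
    rw [Finset.prod_insert hps, Finset.card_insert_of_notMem hps, pow_succ]
    set M := ∏ p ∈ s, (1 - (p : ℝ)⁻¹)
    have e : (y - x) * ((1 - (p : ℝ)⁻¹) * M) = (y - x) * M - (y / p - x / p) * M := by
      field_simp
    rw [e]
    rw [hcount'] at h1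
    rw [abs_le] at h1 h2 ⊢
    constructor <;> linarith [h1.1, h1.2, h2.1, h2.2]

theorem int_gcd_eq_one_iff {q : ℕ} (hq : q ≠ 0) (a : ℤ) :
    Int.gcd a q = 1 ↔ ∀ p ∈ q.primeFactors, ¬ (p : ℤ) ∣ a := by
  rw [Int.gcd_def, Int.natAbs_natCast]
  constructor
  · intro h p hp hpa
    rw [Nat.mem_primeFactors] at hp
    exact hp.1.one_lt.ne' (Nat.eq_one_of_dvd_coprimes h (Int.natCast_dvd.1 hpa) hp.2.1)
  · intro h
    by_contra hne
    obtain ⟨p, hp, hpd⟩ := Nat.exists_prime_and_dvd hne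
    exact h p (Nat.mem_primeFactors.2 ⟨hp, hpd.trans (Nat.gcd_dvd_right _ _), hq⟩)
      (Int.natCast_dvd.2 (hpd.trans (Nat.gcd_dvd_left _ _)))

theorem abs_card_coprime_Icc_sub_le {q : ℕ} (hq : q ≠ 0) {x y : ℝ} (hxy : x ≤ y) :
    |(((Finset.Icc ⌈x⌉ ⌊y⌋).filter fun a => Int.gcd a q = 1).card : ℝ) -
      (y - x) * (q.totient / q)| ≤ 2 ^ q.primeFactors.card := by
  have h := abs_card_sifted_sub_le q.primeFactors
    (fun p hp => Nat.prime_of_mem_primeFactors hp) hxy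
  simpa only [int_gcd_eq_one_iff hq, totient_div_eq_prod hq] using h

theorem sq_two_pow_card_primeFactors_le {q : ℕ} (hq : q ≠ 0) :
    ((2 : ℝ) ^ q.primeFactors.card) ^ 2 ≤ 16 * q.totient := by
  have h := four_pow_card_primeFactors_le hq
  have h' : (4 : ℝ) ^ q.primeFactors.card ≤ 16 * q.totient := by exact_mod_cast h
  rw [← pow_mul, mul_comm, pow_mul]
  norm_num
  exact h'

theorem card_coprimeNumerators_le (γ : ℝ) {q : ℕ} (hq : q ≠ 0) :
    ((coprimeNumerators γ q).card : ℝ) ≤ 7 * q.totient := by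
  have hq0 : (0 : ℝ) < q := by exact_mod_cast Nat.pos_of_ne_zero hq
  have h := abs_card_coprime_Icc_sub_le hq (x := -(q : ℝ) - γ) (y := 2 * q - γ) (by linarith)
  have h1 := sq_two_pow_card_primeFactors_le hq
  have hφ : (1 : ℝ) ≤ q.totient := by
    exact_mod_cast Nat.totient_pos.2 (Nat.pos_of_ne_zero hq)
  have h2 : (2 : ℝ) ^ q.primeFactors.card ≤ 4 * q.totient := by
    refine le_of_sq_le_sq ?_ (by positivity)
    nlinarith
  have h3 : (2 * (q : ℝ) - γ - (-(q : ℝ) - γ)) * (q.totient / q) = 3 * q.totient := by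
    field_simp; ring
  rw [h3, abs_le] at h
  rw [coprimeNumerators]
  linarith [h.2]

/-- The error is at most `4 √φ(q)` and the main term at least `ℓ φ(q)`, so the error is below half
of it once `φ(q) ≥ 64 / ℓ ^ 2`, uniformly in the interval. -/
theorem eventually_le_card_coprime_Icc {ℓ : ℝ} (hℓ : 0 < ℓ) :
    ∀ᶠ q : ℕ in atTop, ∀ x y : ℝ, ℓ * q ≤ y - x →
      (y - x) * (q.totient / q) / 2 ≤
        (((Finset.Icc ⌈x⌉ ⌊y⌋).filter fun a => Int.gcd a q = 1).card : ℝ) := by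
  have ht : Tendsto (fun n : ℕ => (n.totient : ℝ)) atTop atTop :=
    tendsto_natCast_atTop_atTop.comp tendsto_totient_atTop
  filter_upwards [ht.eventually_ge_atTop (64 / ℓ ^ 2), eventually_ne_atTop 0] with q hq hq0 x y hxy
  have hqpos : (0 : ℝ) < q := by exact_mod_cast Nat.pos_of_ne_zero hq0
  have hxy' : x ≤ y := by have : 0 < ℓ * q := by positivity
                          linarith
  have h := abs_card_coprime_Icc_sub_le hq0 hxy'
  have h1 := sq_two_pow_card_primeFactors_le hq0
  have h2 : (2 : ℝ) ^ q.primeFactors.card ≤ ℓ * q.totient / 2 := by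
    refine le_of_sq_le_sq ?_ (by positivity)
    rw [div_le_iff₀ (by positivity)] at hq
    have : (0 : ℝ) ≤ q.totient := Nat.cast_nonneg _
    nlinarith
  have h3 : ℓ * q.totient ≤ (y - x) * (q.totient / q) := by
    calc ℓ * q.totient = ℓ * q * (q.totient / q) := by field_simp
      _ ≤ _ := by gcongr
  rw [abs_le] at h
  linarith [h.1]

/-! ### First and second moments of the counting functions. -/

theorem min_le_volume_closedBall_inter_Icc {z ρ u v : ℝ} (hρ : 0 ≤ ρ) (huv : u ≤ v)
    (h : |z - (u + v) / 2| ≤ max ρ ((v - u) / 2)) :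
    min ρ ((v - u) / 2) ≤ volume.real (Metric.closedBall z ρ ∩ Set.Icc u v) := by
  rw [Real.closedBall_eq_Icc, Set.Icc_inter_Icc, Real.volume_real_Icc]
  refine le_max_of_le_left ?_
  rw [abs_le] at h
  rcases le_total ρ ((v - u) / 2) with h1 | h1
  · rw [max_eq_right h1] at h
    rw [min_eq_left h1]
    rcases min_cases (z + ρ) v with h2 | h2 <;> rcases max_cases (z - ρ) u with h3 | h3 <;>
      linarith
  · rw [max_eq_left h1] at h
    rw [min_eq_right h1]
    rcases min_cases (z + ρ) v with h2 | h2 <;> rcases max_cases (z - ρ) u with h3 | h3 <;>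
      linarith

theorem volume_closedBall_inter_le {z z' ρ ρ' : ℝ} (hρ : 0 ≤ ρ) (hρ' : 0 ≤ ρ') :
    volume.real (Metric.closedBall z ρ ∩ Metric.closedBall z' ρ') ≤ 2 * min ρ ρ' := by
  rw [Real.closedBall_eq_Icc, Real.closedBall_eq_Icc, Set.Icc_inter_Icc, Real.volume_real_Icc]
  refine max_le ?_ (by positivity)
  rcases min_cases ρ ρ' with h | h
  · rw [h.1]
    linarith [min_le_left (z + ρ) (z' + ρ'), le_max_left (z - ρ) (z' - ρ')]
  · rw [h.1]
    linarith [min_le_right (z + ρ) (z' + ρ'), le_max_right (z - ρ) (z' - ρ')]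

theorem closedBall_inter_eq_empty {z z' ρ ρ' : ℝ} (h : ρ + ρ' < |z - z'|) :
    Metric.closedBall z ρ ∩ Metric.closedBall z' ρ' = ∅ := by
  rw [← Set.disjoint_iff_inter_eq_empty]
  exact Metric.closedBall_disjoint_closedBall (by rwa [Real.dist_eq])

/-- The number of `a` in `coprimeNumerators γ q` with `|x - (a + γ) / q| ≤ ψ q / q`. -/
noncomputable def approxCount (γ : ℝ) (ψ : ℕ → ℝ≥0) (q : ℕ) (x : ℝ) : ℝ :=
  ∑ a ∈ coprimeNumerators γ q,
    (Metric.closedBall (((a : ℝ) + γ) / q) (ψ q / q)).indicator (fun _ => (1 : ℝ)) x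

theorem approxCount_nonneg (γ : ℝ) (ψ : ℕ → ℝ≥0) (q : ℕ) (x : ℝ) : 0 ≤ approxCount γ ψ q x :=
  Finset.sum_nonneg fun _ _ => Set.indicator_nonneg (fun _ _ => zero_le_one) _

theorem integrable_indicator_closedBall (z ρ : ℝ) :
    Integrable ((Metric.closedBall z ρ).indicator fun _ => (1 : ℝ)) := by
  rw [integrable_indicator_iff measurableSet_closedBall]
  exact integrableOn_const measure_closedBall_lt_top.ne

theorem indicator_mul_indicator_one (A B : Set ℝ) (x : ℝ) :
    A.indicator (fun _ => (1 : ℝ)) x * B.indicator (fun _ => 1) x =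
      (A ∩ B).indicator (fun _ => 1) x := by
  classical
  simp only [Set.indicator_apply, Set.mem_inter_iff]
  split_ifs <;> simp_all

theorem integrable_indicator_closedBall_inter (z ρ z' ρ' : ℝ) :
    Integrable ((Metric.closedBall z ρ ∩ Metric.closedBall z' ρ').indicator fun _ => (1 : ℝ)) := by
  rw [integrable_indicator_iff (measurableSet_closedBall.inter measurableSet_closedBall)]
  exact integrableOn_const
    ((measure_mono Set.inter_subset_left).trans_lt measure_closedBall_lt_top).ne

theorem integrable_approxCount (γ : ℝ) (ψ : ℕ → ℝ≥0) (q : ℕ) : Integrable (approxCount γ ψ q) :=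
  integrable_finsetSum _ fun _ _ => integrable_indicator_closedBall _ _

theorem approxCount_mul_eq (γ : ℝ) (ψ : ℕ → ℝ≥0) (q r : ℕ) (x : ℝ) :
    approxCount γ ψ q x * approxCount γ ψ r x =
      ∑ y ∈ coprimeNumerators γ q ×ˢ coprimeNumerators γ r,
        (Metric.closedBall (((y.1 : ℝ) + γ) / q) (ψ q / q) ∩
          Metric.closedBall (((y.2 : ℝ) + γ) / r) (ψ r / r)).indicator (fun _ => 1) x := by
  rw [approxCount, approxCount, Finset.sum_mul_sum, Finset.sum_product]
  simp only [indicator_mul_indicator_one]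

theorem integrable_approxCount_mul (γ : ℝ) (ψ : ℕ → ℝ≥0) (q r : ℕ) :
    Integrable fun x => approxCount γ ψ q x * approxCount γ ψ r x := by
  simp only [approxCount_mul_eq]
  exact integrable_finsetSum _ fun _ _ => integrable_indicator_closedBall_inter _ _ _ _

theorem setIntegral_approxCount (γ : ℝ) (ψ : ℕ → ℝ≥0) (q : ℕ) (A : Set ℝ) :
    ∫ x in A, approxCount γ ψ q x =
      ∑ a ∈ coprimeNumerators γ q,
        volume.real (Metric.closedBall (((a : ℝ) + γ) / q) (ψ q / q) ∩ A) := by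
  unfold approxCount
  rw [integral_finsetSum _ fun _ _ => (integrable_indicator_closedBall _ _).restrict]
  refine Finset.sum_congr rfl fun a _ => ?_
  rw [integral_indicator_const _ measurableSet_closedBall, smul_eq_mul, mul_one,
    measureReal_restrict_apply measurableSet_closedBall]

theorem setIntegral_approxCount_mul_le (γ : ℝ) (ψ : ℕ → ℝ≥0) (q r : ℕ) (A : Set ℝ) :
    ∫ x in A, approxCount γ ψ q x * approxCount γ ψ r x ≤
      ∑ y ∈ coprimeNumerators γ q ×ˢ coprimeNumerators γ r,
        volume.real (Metric.closedBall (((y.1 : ℝ) + γ) / q) (ψ q / q) ∩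
          Metric.closedBall (((y.2 : ℝ) + γ) / r) (ψ r / r)) := by
  refine (setIntegral_le_integral (integrable_approxCount_mul γ ψ q r)
    (Eventually.of_forall fun x =>
      mul_nonneg (approxCount_nonneg _ _ _ _) (approxCount_nonneg _ _ _ _))).trans ?_
  simp only [approxCount_mul_eq]
  rw [integral_finsetSum _ fun _ _ => integrable_indicator_closedBall_inter _ _ _ _]
  refine Finset.sum_le_sum fun y _ => ?_
  rw [integral_indicator_const _ (measurableSet_closedBall.inter measurableSet_closedBall),
    smul_eq_mul, mul_one]

theorem eq_and_eq_of_mul_eq_mul {a b : ℤ} {q r : ℕ} (hq : q ≠ 0) (ha : Int.gcd a q = 1)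
    (hb : Int.gcd b r = 1) (h : a * r = b * q) : q = r ∧ a = b := by
  have ha' : IsCoprime (q : ℤ) a := (Int.isCoprime_iff_gcd_eq_one.2 ha).symm
  have hb' : IsCoprime (r : ℤ) b := (Int.isCoprime_iff_gcd_eq_one.2 hb).symm
  have h1 : (q : ℤ) ∣ r := ha'.dvd_of_dvd_mul_left ⟨b, by rw [h]; ring⟩
  have h2 : (r : ℤ) ∣ q := hb'.dvd_of_dvd_mul_left ⟨a, by rw [← h]; ring⟩
  have h3 : q = r := Nat.dvd_antisymm (Int.natCast_dvd_natCast.1 h1) (Int.natCast_dvd_natCast.1 h2)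
  subst h3
  exact ⟨rfl, mul_right_cancel₀ (by exact_mod_cast hq : (q : ℤ) ≠ 0) h⟩

/-- Pairs of numerators are of three kinds: far pairs have disjoint balls, close pairs with `a r ≠ b
q` give the product term, and `a r = b q` between reduced fractions forces `q = r`, `a = b`, giving
the diagonal term. -/
theorem exists_setIntegral_approxCount_mul_le (γ : ℝ) {δ : ℝ} (hδ : 0 < δ) :
    ∃ C : ℝ, 0 < C ∧ ∀ (ψ : ℕ → ℝ≥0) (q r : ℕ) (A : Set ℝ), q ≠ 0 → r ≠ 0 →
      (ψ q ≠ 0 → δ ≤ (ψ q : ℝ)) → (ψ r ≠ 0 → δ ≤ (ψ r : ℝ)) →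
      ∫ x in A, approxCount γ ψ q x * approxCount γ ψ r x ≤
        C * ((q.totient : ℝ) * ψ q / q) * ((r.totient : ℝ) * ψ r / r) +
          if q = r then C * ((q.totient : ℝ) * ψ q / q) else 0 := by
  classical
  obtain ⟨C, hC, hpairs⟩ := exists_card_close_pairs_le γ hδ
  refine ⟨4 * C + 14, by positivity, fun ψ q r A hq hr hψq hψr => ?_⟩
  refine (setIntegral_approxCount_mul_le γ ψ q r A).trans ?_
  have hq0 : (0 : ℝ) < q := by exact_mod_cast Nat.pos_of_ne_zero hq
  have hr0 : (0 : ℝ) < r := by exact_mod_cast Nat.pos_of_ne_zero hr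
  have hρq : (0 : ℝ) ≤ ψ q / q := by positivity
  have hρr : (0 : ℝ) ≤ ψ r / r := by positivity
  set T := coprimeNumerators γ q ×ˢ coprimeNumerators γ r with hT
  set μ : ℤ × ℤ → ℝ := fun y =>
    volume.real (Metric.closedBall (((y.1 : ℝ) + γ) / q) (ψ q / q) ∩
          Metric.closedBall (((y.2 : ℝ) + γ) / r) (ψ r / r)) with hμ
  have hμle : ∀ y, μ y ≤ 2 * min ((ψ q : ℝ) / q) (ψ r / r) := fun y =>
    volume_closedBall_inter_le hρq hρr
  set wq := (q.totient : ℝ) * ψ q / q with hwq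
  set wr := (r.totient : ℝ) * ψ r / r with hwr
  have hwq0 : 0 ≤ wq := by positivity
  have hwr0 : 0 ≤ wr := by positivity
  have hdiag0 : (0 : ℝ) ≤ if q = r then (4 * C + 14) * wq else 0 := by
    split_ifs <;> positivity
  -- The lower bound `δ` is unavailable here, but one of the radii vanishes and every overlap is
  -- null.
  by_cases h0 : ψ q = 0 ∨ ψ r = 0
  · have hmin : min ((ψ q : ℝ) / q) (ψ r / r) ≤ 0 := by
      rcases h0 with h | h
      · exact (min_le_left _ _).trans (by rw [h]; simp)
      · exact (min_le_right _ _).trans (by rw [h]; simp)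
    calc ∑ y ∈ T, μ y ≤ ∑ y ∈ T, 0 := Finset.sum_le_sum fun y _ => (hμle y).trans (by linarith)
      _ ≤ _ := by
        rw [Finset.sum_const_zero]
        positivity
  push Not at h0
  have hcard := hpairs q r (ψ q) (ψ r) hq hr (hψq h0.1) (hψr h0.2)
  rw [← hT] at hcard
  rw [← Finset.sum_filter_add_sum_filter_not T (fun y => y.1 * (r : ℤ) ≠ y.2 * (q : ℤ))]
  refine add_le_add ?_ ?_
  · rw [← Finset.sum_filter_add_sum_filter_not _ (fun y : ℤ × ℤ =>
      |((y.1 : ℝ) + γ) * r - (y.2 + γ) * q| ≤ ψ q * r + ψ r * q), Finset.filter_filter]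
    have hfar : ∑ y ∈ (T.filter fun y => y.1 * (r : ℤ) ≠ y.2 * (q : ℤ)).filter (fun y : ℤ × ℤ =>
        ¬ |((y.1 : ℝ) + γ) * r - (y.2 + γ) * q| ≤ ψ q * r + ψ r * q), μ y = 0 := by
      refine Finset.sum_eq_zero fun y hy => ?_
      have hy := (Finset.mem_filter.1 hy).2
      rw [not_le] at hy
      have : (ψ q : ℝ) / q + ψ r / r < |((y.1 : ℝ) + γ) / q - ((y.2 : ℝ) + γ) / r| := by
        have e : ((y.1 : ℝ) + γ) / q - ((y.2 : ℝ) + γ) / r =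
            (((y.1 : ℝ) + γ) * r - (y.2 + γ) * q) / (q * r) := by field_simp
        have e2 : (ψ q : ℝ) / q + ψ r / r = (ψ q * r + ψ r * q) / (q * r) := by field_simp
        rw [e, e2, abs_div, abs_of_pos (mul_pos hq0 hr0)]
        gcongr
      simp only [hμ]
      rw [closedBall_inter_eq_empty this, measureReal_empty]
    rw [hfar, add_zero]
    refine (Finset.sum_le_card_nsmul _ _ _ fun y _ => hμle y).trans ?_
    rw [nsmul_eq_mul]
    -- Bounding the minimum by the opposite radius in each summand turns overlap length times pair
    -- count into `ψ q * ψ r`.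
    have hprod : min ((ψ q : ℝ) / q) (ψ r / r) * (ψ q * r + ψ r * q) ≤ 2 * (ψ q * ψ r) := by
      have h1 : min ((ψ q : ℝ) / q) (ψ r / r) * (ψ q * r) ≤ ψ r / r * (ψ q * r) :=
        mul_le_mul_of_nonneg_right (min_le_right _ _) (by positivity)
      have h2 : min ((ψ q : ℝ) / q) (ψ r / r) * (ψ r * q) ≤ ψ q / q * (ψ r * q) :=
        mul_le_mul_of_nonneg_right (min_le_left _ _) (by positivity)
      have e1 : (ψ r : ℝ) / r * (ψ q * r) = ψ q * ψ r := by field_simp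
      have e2 : (ψ q : ℝ) / q * (ψ r * q) = ψ q * ψ r := by field_simp
      rw [mul_add]
      linarith
    calc _ ≤ C * (ψ q * r + ψ r * q) * ((q.totient : ℝ) / q * ((r.totient : ℝ) / r)) *
          (2 * min ((ψ q : ℝ) / q) (ψ r / r)) :=
          mul_le_mul_of_nonneg_right hcard (by positivity)
      _ = 2 * C * ((q.totient : ℝ) / q * ((r.totient : ℝ) / r)) *
          (min ((ψ q : ℝ) / q) (ψ r / r) * (ψ q * r + ψ r * q)) := by ring
      _ ≤ 2 * C * ((q.totient : ℝ) / q * ((r.totient : ℝ) / r)) * (2 * (ψ q * ψ r)) := by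
          gcongr
      _ = 4 * C * wq * wr := by rw [hwq, hwr]; ring
      _ ≤ _ := by gcongr; linarith
  · have hmem : ∀ y ∈ T.filter (fun y => ¬ y.1 * (r : ℤ) ≠ y.2 * (q : ℤ)),
        q = r ∧ y.1 = y.2 := by
      intro y hy
      rw [Finset.mem_filter, hT, Finset.mem_product, not_not] at hy
      exact eq_and_eq_of_mul_eq_mul hq (mem_coprimeNumerators.1 hy.1.1).2
        (mem_coprimeNumerators.1 hy.1.2).2 hy.2
    split_ifs with hqr
    · have hc : ((T.filter (fun y => ¬ y.1 * (r : ℤ) ≠ y.2 * (q : ℤ))).card : ℝ) ≤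
          7 * q.totient := by
        refine le_trans (Nat.cast_le.2 ?_) (card_coprimeNumerators_le γ hq)
        refine Finset.card_le_card_of_injOn (fun y => y.1) (fun y hy => ?_) ?_
        · have hy := (Finset.mem_filter.1 hy).1
          exact (Finset.mem_product.1 hy).1
        · intro x hx y hy hxy
          refine Prod.ext hxy ?_
          rw [← (hmem x hx).2, ← (hmem y hy).2]
          exact hxy
      refine (Finset.sum_le_card_nsmul _ μ (2 * ((ψ q : ℝ) / q)) fun y _ => (hμle y).trans ?_).trans ?_
      · gcongr
        exact min_le_left _ _
      · rw [nsmul_eq_mul]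
        calc _ ≤ 7 * (q.totient : ℝ) * (2 * (ψ q / q)) :=
              mul_le_mul_of_nonneg_right hc (by positivity)
          _ = 14 * wq := by rw [hwq]; ring
          _ ≤ _ := by gcongr; linarith
    · refine (Finset.sum_eq_zero fun y hy => absurd (hmem y hy).1 hqr).le

/-- The condition `ψ q < q` keeps `R ≤ 1`, so all centres used lie in `[-1, 2]`, the range covered
by `coprimeNumerators`. -/
theorem eventually_le_setIntegral_approxCount (γ : ℝ) (ψ : ℕ → ℝ≥0)
    (hψ : ∀ᶠ q : ℕ in atTop, (ψ q : ℝ) < q) {u v : ℝ} (hu : 0 ≤ u) (huv : u < v) (hv : v ≤ 1) :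
    ∀ᶠ q : ℕ in atTop, 1 / 2 * (v - u) * ((q.totient : ℝ) * ψ q / q) ≤
      ∫ x in Set.Icc u v, approxCount γ ψ q x := by
  filter_upwards [hψ, eventually_le_card_coprime_Icc (sub_pos.2 huv), eventually_ne_atTop 0]
    with q hψq hcount hq
  have hq0 : (0 : ℝ) < q := by exact_mod_cast Nat.pos_of_ne_zero hq
  rw [setIntegral_approxCount]
  set ρ : ℝ := ψ q / q with hρ
  have hρ0 : 0 ≤ ρ := by positivity
  have hρ1 : ρ < 1 := by rw [hρ, div_lt_one hq0]; exact hψq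
  set c : ℝ := (u + v) / 2 with hc
  -- Centres within `R` of the midpoint number about `R φ(q)` at least, each contributing `min ρ ((v
  -- - u) / 2)`. Since `max * min` is the product, short and long balls need no separate treatment.
  set R : ℝ := max ρ ((v - u) / 2) with hR
  have hR1 : R ≤ 1 := max_le hρ1.le (by linarith)
  have hRl : (v - u) / 2 ≤ R := le_max_right _ _
  set S := (Finset.Icc ⌈q * (c - R) - γ⌉ ⌊q * (c + R) - γ⌋).filter fun a => Int.gcd a q = 1 with hS
  have hcard := hcount (q * (c - R) - γ) (q * (c + R) - γ) (by nlinarith)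
  rw [← hS] at hcard
  have hsub : S ⊆ coprimeNumerators γ q := by
    intro a ha
    rw [hS, Finset.mem_filter, Finset.mem_Icc, Int.ceil_le, Int.le_floor] at ha
    rw [mem_coprimeNumerators]
    refine ⟨⟨?_, ?_⟩, ha.2⟩
    · have : -(q : ℝ) ≤ q * (c - R) := by nlinarith
      linarith [ha.1.1]
    · have : q * (c + R) ≤ 2 * (q : ℝ) := by nlinarith
      linarith [ha.1.2]
  have hball : ∀ a ∈ S, min ρ ((v - u) / 2) ≤
      volume.real (Metric.closedBall (((a : ℝ) + γ) / q) ρ ∩ Set.Icc u v) := by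
    intro a ha
    rw [hS, Finset.mem_filter, Finset.mem_Icc, Int.ceil_le, Int.le_floor] at ha
    refine min_le_volume_closedBall_inter_Icc hρ0 huv.le ?_
    rw [← hR, ← hc, abs_le, le_sub_iff_add_le, sub_le_iff_le_add, le_div_iff₀ hq0, div_le_iff₀ hq0]
    constructor <;> linarith [ha.1.1, ha.1.2]
  calc 1 / 2 * (v - u) * ((q.totient : ℝ) * ψ q / q)
      = (R * q.totient) * min ρ ((v - u) / 2) := by
        have : R * min ρ ((v - u) / 2) = ρ * ((v - u) / 2) := by
          rw [hR, mul_comm, min_mul_max]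
        calc _ = (ρ * ((v - u) / 2)) * q.totient := by rw [hρ]; ring
          _ = _ := by rw [← this]; ring
    _ ≤ S.card * min ρ ((v - u) / 2) := by
        refine mul_le_mul_of_nonneg_right ?_ (le_min hρ0 (by linarith))
        refine le_trans (le_of_eq ?_) hcard
        field_simp
        ring
    _ ≤ ∑ a ∈ S, volume.real (Metric.closedBall (((a : ℝ) + γ) / q) ρ ∩ Set.Icc u v) := by
        rw [← nsmul_eq_mul]
        exact Finset.card_nsmul_le_sum _ _ _ hball
    _ ≤ _ := Finset.sum_le_sum_of_subset_of_nonneg hsub fun _ _ _ => measureReal_nonneg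

/-! ### From moment bounds to full measure. -/

theorem IsOpen.exists_finset_disjoint_closedBall {V : Set ℝ} (hV : IsOpen V) {a : ENNReal}
    (ha : a < volume V) :
    ∃ (s : Finset ℝ) (r : ℝ → ℝ), (∀ x ∈ s, 0 < r x ∧ Metric.closedBall x (r x) ⊆ V) ∧
      (s : Set ℝ).PairwiseDisjoint (fun x => Metric.closedBall x (r x)) ∧
      a < ∑ x ∈ s, volume (Metric.closedBall x (r x)) := by
  classical
  obtain ⟨t, r, htc, -, htr, ht0, htd⟩ :=
    Besicovitch.exists_disjoint_closedBall_covering_ae volume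
      (fun x => {ρ : ℝ | Metric.closedBall x ρ ⊆ V}) V (by
        intro x hx δ hδ
        obtain ⟨ε, hε, hsub⟩ := Metric.isOpen_iff.1 hV x hx
        have hm : 0 < min ε δ := lt_min hε hδ
        refine ⟨min ε δ / 2, ?_, by linarith, by linarith [min_le_right ε δ]⟩
        refine (Metric.closedBall_subset_ball ?_).trans hsub
        linarith [min_le_left ε δ]) (fun _ => 1) (fun _ _ => one_pos)
  have h1 : volume V ≤ volume (⋃ x ∈ t, Metric.closedBall x (r x)) :=
    measure_mono_ae (ae_le_set.2 ht0)
  rw [measure_biUnion htc htd fun _ _ => measurableSet_closedBall, ENNReal.tsum_eq_iSup_sum] at h1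
  obtain ⟨s, hs⟩ := lt_iSup_iff.1 (ha.trans_le h1)
  refine ⟨s.map (Function.Embedding.subtype _), r, ?_, ?_, ?_⟩
  · intro x hx
    obtain ⟨y, -, rfl⟩ := Finset.mem_map.1 hx
    exact ⟨(htr y.1 y.2).2.1, (htr y.1 y.2).1⟩
  · refine htd.subset fun x hx => ?_
    obtain ⟨y, -, rfl⟩ := Finset.mem_map.1 hx
    exact y.2
  · rw [Finset.sum_map]
    exact hs

theorem exists_volume_diff_biUnion_lt {E : ℕ → Set ℝ} (hE : ∀ q, IsClosed (E q)) (N : ℕ)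
    {ε : ℝ} (hε : 0 < ε) :
    ∃ M, volume ((Set.Icc (0 : ℝ) 1 ∩ ⋃ q ≥ N, E q) \ ⋃ q ∈ Finset.Ico N M, E q) <
      ENNReal.ofReal ε := by
  set U := ⋃ q ≥ N, E q with hU
  set D : ℕ → Set ℝ := fun M => (Set.Icc (0 : ℝ) 1 ∩ U) \ ⋃ q ∈ Finset.Ico N M, E q with hD
  have hUm : MeasurableSet U :=
    MeasurableSet.iUnion fun q => MeasurableSet.iUnion fun _ => (hE q).measurableSet
  have hDm : ∀ M, MeasurableSet (D M) := fun M =>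
    (measurableSet_Icc.inter hUm).diff
      (Finset.measurableSet_biUnion _ fun q _ => (hE q).measurableSet)
  have hanti : Antitone D := by
    intro a b hab
    refine Set.sdiff_subset_sdiff_right ?_
    exact Set.biUnion_subset_biUnion_left fun q hq => by
      simp only [Finset.mem_coe, Finset.mem_Ico] at hq ⊢
      omega
  have hlim := tendsto_measure_iInter_atTop (μ := volume)
    (fun M => (hDm M).nullMeasurableSet) hanti
    ⟨0, ((measure_mono (Set.sdiff_subset.trans Set.inter_subset_left)).trans_lt
      measure_Icc_lt_top).ne⟩
  have hempty : ⋂ M, D M = ∅ := by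
    rw [Set.eq_empty_iff_forall_notMem]
    intro x hx
    rw [Set.mem_iInter] at hx
    obtain ⟨q, hq⟩ := Set.mem_iUnion.1 (hx 0).1.2
    obtain ⟨hqN, hxq⟩ := Set.mem_iUnion.1 hq
    refine (hx (q + 1)).2 ?_
    rw [Set.mem_iUnion₂]
    exact ⟨q, Finset.mem_Ico.2 ⟨hqN, Nat.lt_succ_self q⟩, hxq⟩
  rw [hempty, measure_empty] at hlim
  exact (hlim.eventually_lt_const (ENNReal.ofReal_pos.2 hε)).exists

/-- A divergence Borel-Cantelli lemma: a lower bound for the mass on every fixed interval and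
quasi-independence on the whole of `[0, 1]` yield full measure. -/
theorem volume_Icc_diff_iUnion_eq_zero {f : ℕ → ℝ → ℝ} {E : ℕ → Set ℝ} {w : ℕ → ℝ} {c C : ℝ}
    (hc : 0 < c) (hC : 0 < C) (hw : ∀ q, 0 ≤ w q) (hE : ∀ q, IsClosed (E q))
    (hf : ∀ q, ∀ x ∈ Set.Icc (0 : ℝ) 1, x ∉ E q → f q x = 0)
    (hf1 : ∀ q, Integrable (f q)) (hf2 : ∀ q r, Integrable fun x => f q x * f r x)
    (hlow : ∀ u v : ℝ, 0 ≤ u → u < v → v ≤ 1 →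
      ∀ᶠ q : ℕ in atTop, c * (v - u) * w q ≤ ∫ x in Set.Icc u v, f q x)
    (hpair : ∀ q r, q ≠ 0 → r ≠ 0 → ∫ x in Set.Icc (0 : ℝ) 1, f q x * f r x ≤
      C * w q * w r + if q = r then C * w q else 0)
    (hdiv : Tendsto (fun Q : ℕ => ∑ q ∈ Finset.Icc 1 Q, w q) atTop atTop) (N : ℕ) :
    volume (Set.Icc (0 : ℝ) 1 \ ⋃ q ≥ N, E q) = 0 := by
  classical
  by_contra hne
  set U := ⋃ q ≥ N, E q with hU
  have hfin : volume (Set.Icc (0 : ℝ) 1 \ U) ≠ ⊤ :=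
    ((measure_mono Set.sdiff_subset).trans_lt measure_Icc_lt_top).ne
  set α : ℝ := volume.real (Set.Icc (0 : ℝ) 1 \ U) with hα
  have hα0 : 0 < α := ENNReal.toReal_pos hne hfin
  -- With `lam = s * W`, each of the two terms in the final upper bound for `2 ∫_A F` is at most `c
  -- α W / 4`, against the lower bound `c α W`. Both `s` and `ε` are fixed before `M`, hence before
  -- the set `A`.
  set s : ℝ := 8 * C / (c * α) with hs
  have hs0 : 0 < s := by positivity
  set ε : ℝ := c * α / (4 * s) with hε
  have hε0 : 0 < ε := by positivity
  obtain ⟨M, hM⟩ := exists_volume_diff_biUnion_lt hE N hε0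
  set UM := ⋃ q ∈ Finset.Ico N M, E q with hUM
  set H := (Set.Icc (0 : ℝ) 1 ∩ U) \ UM with hH
  have hUMU : UM ⊆ U := by
    intro x hx
    obtain ⟨q, hq, hxq⟩ := Set.mem_iUnion₂.1 hx
    exact Set.mem_iUnion₂.2 ⟨q, (Finset.mem_Ico.1 hq).1, hxq⟩
  have hHm : MeasurableSet H :=
    (measurableSet_Icc.inter (MeasurableSet.iUnion fun q => MeasurableSet.iUnion fun _ =>
      (hE q).measurableSet)).diff
      (Finset.measurableSet_biUnion _ fun q _ => (hE q).measurableSet)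
  -- Removing only finitely many `E q` leaves an open set, so it contains finitely many disjoint
  -- intervals of total length above `α / 2`, on which `hlow` applies. Later `E q` can meet these
  -- intervals only inside the small set `H`.
  set V := Set.Ioo (0 : ℝ) 1 \ UM with hV
  have hVo : IsOpen V := by
    refine isOpen_Ioo.sdiff ?_
    exact (Finset.finite_toSet _).isClosed_biUnion fun q _ => hE q
  have hVα : ENNReal.ofReal (α / 2) < volume V := by
    have h1 : volume (Set.Icc (0 : ℝ) 1 \ U) ≤ volume V := by
      have h2 : volume (Set.Icc (0 : ℝ) 1 \ UM) = volume V :=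
        measure_congr ((Ioo_ae_eq_Icc.symm).diff (ae_eq_refl UM))
      rw [← h2]
      exact measure_mono (Set.sdiff_subset_sdiff_right hUMU)
    refine lt_of_lt_of_le ?_ h1
    rw [← ofReal_measureReal hfin]
    exact (ENNReal.ofReal_lt_ofReal_iff hα0).2 (by linarith)
  obtain ⟨S, r, hSr, hSd, hSs⟩ := hVo.exists_finset_disjoint_closedBall hVα
  have hsum : α / 2 ≤ ∑ x ∈ S, 2 * r x := by
    simp only [Real.volume_closedBall] at hSs
    rw [← ENNReal.ofReal_sum_of_nonneg fun x hx => by linarith [(hSr x hx).1]] at hSs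
    exact (ENNReal.ofReal_lt_ofReal_iff'.1 hSs).1.le
  set A := ⋃ x ∈ S, Metric.closedBall x (r x) with hA
  have hAV : A ⊆ V := Set.iUnion₂_subset fun x hx => (hSr x hx).2
  have hAI : A ⊆ Set.Icc 0 1 := fun x hx => Set.Ioo_subset_Icc_self (hAV hx).1
  have hAm : MeasurableSet A := Finset.measurableSet_biUnion _ fun _ _ => measurableSet_closedBall
  have hlowA : ∀ᶠ q : ℕ in atTop, c * (α / 2) * w q ≤ ∫ x in A, f q x := by
    have hev : ∀ᶠ q : ℕ in atTop, ∀ x ∈ S,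
        c * (2 * r x) * w q ≤ ∫ y in Metric.closedBall x (r x), f q y := by
      rw [Filter.eventually_all_finset]
      intro x hx
      obtain ⟨hr0, hrV⟩ := hSr x hx
      rw [Real.closedBall_eq_Icc] at hrV ⊢
      have h0 := (hrV (Set.left_mem_Icc.2 (by linarith))).1.1
      have h1 := (hrV (Set.right_mem_Icc.2 (by linarith))).1.2
      filter_upwards [hlow (x - r x) (x + r x) h0.le (by linarith) h1.le] with q hq
      refine le_trans (le_of_eq ?_) hq
      ring
    filter_upwards [hev] with q hq
    rw [hA, integral_biUnion_finset S (fun _ _ => measurableSet_closedBall) hSd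
      fun _ _ => (hf1 q).integrableOn]
    calc c * (α / 2) * w q ≤ c * (∑ x ∈ S, 2 * r x) * w q := by
          have := hw q
          gcongr
      _ = ∑ x ∈ S, c * (2 * r x) * w q := by rw [Finset.mul_sum, Finset.sum_mul]
      _ ≤ _ := Finset.sum_le_sum hq
  obtain ⟨q₀, hq₀⟩ := eventually_atTop.1 hlowA
  set q₁ := max q₀ (max N 1) with hq₁
  -- Having `W ≥ 1` absorbs the diagonal contribution `C * W` into `C * W ^ 2`.
  obtain ⟨Q, hQ⟩ : ∃ Q, 1 ≤ ∑ q ∈ Finset.Ico q₁ Q, w q := by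
    obtain ⟨Q, hQ⟩ := (hdiv.eventually_ge_atTop (1 + ∑ q ∈ Finset.Icc 1 q₁, w q)).exists
    refine ⟨Q + 1, ?_⟩
    have : ∑ q ∈ Finset.Icc 1 Q, w q ≤
        ∑ q ∈ Finset.Icc 1 q₁, w q + ∑ q ∈ Finset.Ico q₁ (Q + 1), w q := by
      rw [← Finset.sum_union_inter]
      refine le_trans ?_ (le_add_of_nonneg_right (Finset.sum_nonneg fun q _ => hw q))
      refine Finset.sum_le_sum_of_subset_of_nonneg ?_ fun q _ _ => hw q
      intro q hq
      simp only [Finset.mem_union, Finset.mem_Icc, Finset.mem_Ico] at hq ⊢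
      omega
    linarith
  set K := Finset.Ico q₁ Q with hK
  set W := ∑ q ∈ K, w q with hW
  have hK' : ∀ q ∈ K, q₀ ≤ q ∧ N ≤ q ∧ q ≠ 0 := by
    intro q hq
    have := (Finset.mem_Ico.1 hq).1
    omega
  set F : ℝ → ℝ := fun x => ∑ q ∈ K, f q x with hF
  have hF1 : Integrable F := integrable_finsetSum _ fun q _ => hf1 q
  have hFsq : ∀ x, F x ^ 2 = ∑ q ∈ K, ∑ r ∈ K, f q x * f r x := by
    intro x
    rw [hF, sq, Finset.sum_mul_sum]
  have hF2 : Integrable fun x => F x ^ 2 := by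
    simp only [hFsq]
    exact integrable_finsetSum _ fun q _ => integrable_finsetSum _ fun r _ => hf2 q r
  have hFlow : c * (α / 2) * W ≤ ∫ x in A, F x := by
    rw [hF, integral_finsetSum _ fun q _ => (hf1 q).restrict, hW, Finset.mul_sum]
    exact Finset.sum_le_sum fun q hq => hq₀ q (hK' q hq).1
  have hFup : ∫ x in Set.Icc (0 : ℝ) 1, F x ^ 2 ≤ C * W ^ 2 + C * W := by
    simp only [hFsq]
    rw [integral_finsetSum _ fun q _ =>
      (integrable_finsetSum _ fun r _ => (hf2 q r)).restrict]
    calc _ = ∑ q ∈ K, ∑ r ∈ K, ∫ x in Set.Icc (0 : ℝ) 1, f q x * f r x :=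
          Finset.sum_congr rfl fun q _ =>
            integral_finsetSum _ fun r _ => (hf2 q r).restrict
      _ ≤ ∑ q ∈ K, ∑ r ∈ K, (C * w q * w r + if q = r then C * w q else 0) :=
          Finset.sum_le_sum fun q hq => Finset.sum_le_sum fun r hr =>
            hpair q r (hK' q hq).2.2 (hK' r hr).2.2
      _ = C * W ^ 2 + C * W := by
          simp only [Finset.sum_add_distrib, Finset.sum_ite_eq]
          congr 1
          · rw [sq, hW, Finset.sum_mul_sum, Finset.mul_sum]
            refine Finset.sum_congr rfl fun q _ => ?_
            rw [Finset.mul_sum]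
            exact Finset.sum_congr rfl fun r _ => by ring
          · rw [hW, Finset.mul_sum]
            exact Finset.sum_congr rfl fun q hq => if_pos hq
  have hW0 : 0 < W := by linarith
  set lam := s * W with hlam
  have hlam0 : 0 < lam := by positivity
  -- On `A` the function `F` vanishes outside `H`; on `H` this is `(F x - lam) ^ 2 ≥ 0`. It plays
  -- the role of Cauchy-Schwarz.
  have hpt : ∀ x ∈ A, 2 * F x ≤ lam⁻¹ * F x ^ 2 + H.indicator (fun _ => lam) x := by
    intro x hx
    by_cases hxU : x ∈ U
    · have hxH : x ∈ H := ⟨⟨hAI hx, hxU⟩, (hAV hx).2⟩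
      rw [Set.indicator_of_mem hxH]
      have h1 := sq_nonneg (F x - lam)
      have h2 : lam⁻¹ * F x ^ 2 + lam - 2 * F x = lam⁻¹ * (F x - lam) ^ 2 := by
        field_simp
        ring
      have h3 : 0 ≤ lam⁻¹ * (F x - lam) ^ 2 := by positivity
      linarith
    · have hF0 : F x = 0 := by
        refine Finset.sum_eq_zero fun q hq => hf q x (hAI hx) fun hxq => hxU ?_
        exact Set.mem_iUnion₂.2 ⟨q, (hK' q hq).2.1, hxq⟩
      rw [hF0]
      have : 0 ≤ H.indicator (fun _ => lam) x := Set.indicator_nonneg (fun _ _ => hlam0.le) x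
      simpa using this
  have hHfin : volume H ≠ ⊤ := (hM.trans ENNReal.ofReal_lt_top).ne
  have hHind : Integrable (H.indicator fun _ => lam) := by
    rw [integrable_indicator_iff hHm]
    exact integrableOn_const hHfin
  have hHε : volume.real H ≤ ε := by
    have := ENNReal.toReal_mono ENNReal.ofReal_ne_top hM.le
    rwa [ENNReal.toReal_ofReal hε0.le] at this
  have hmain : 2 * ∫ x in A, F x ≤ lam⁻¹ * (C * W ^ 2 + C * W) + lam * ε := by
    calc 2 * ∫ x in A, F x = ∫ x in A, 2 * F x := (integral_const_mul _ _).symm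
      _ ≤ ∫ x in A, (lam⁻¹ * F x ^ 2 + H.indicator (fun _ => lam) x) :=
          setIntegral_mono_on (hF1.const_mul 2).integrableOn
            ((hF2.const_mul _).add hHind).integrableOn hAm hpt
      _ = lam⁻¹ * (∫ x in A, F x ^ 2) + ∫ x in A, H.indicator (fun _ => lam) x := by
          rw [integral_add (hF2.const_mul _).restrict hHind.restrict, integral_const_mul]
      _ ≤ _ := by
          refine add_le_add (mul_le_mul_of_nonneg_left (le_trans ?_ hFup) (by positivity)) ?_
          · exact setIntegral_mono_set hF2.integrableOn
              (Eventually.of_forall fun x => sq_nonneg _) (Eventually.of_forall hAI)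
          · refine (setIntegral_le_integral hHind (Eventually.of_forall fun x =>
              Set.indicator_nonneg (fun _ _ => hlam0.le) x)).trans ?_
            rw [integral_indicator_const _ hHm, smul_eq_mul, mul_comm]
            gcongr
  have h1 : lam⁻¹ * (C * W ^ 2 + C * W) ≤ c * α / 4 * W := by
    have e : c * α / 4 * W = lam⁻¹ * (2 * C * W ^ 2) := by
      rw [hlam, hs]; field_simp; ring
    rw [e]
    refine mul_le_mul_of_nonneg_left ?_ (by positivity)
    nlinarith [mul_le_mul_of_nonneg_left hQ (mul_pos hC hW0).le]
  have h2 : lam * ε = c * α / 4 * W := by rw [hlam, hε]; field_simp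
  have h3 : 0 < c * α * W := by positivity
  linarith

/-! ### The theorem. -/

/-- Numerators congruent to `1` modulo `q` are coprime to `q` and give points spaced by `1`, so
radius at least `1` already covers everything. -/
theorem coprimeApproxSet_eq_Icc (γ : ℝ) (ψ : ℕ → ℝ≥0) {q : ℕ} (hq : q ≠ 0)
    (hψ : (q : ℝ) ≤ ψ q) : coprimeApproxSet γ ψ q = Set.Icc 0 1 := by
  refine Set.Subset.antisymm (fun x hx => hx.1) fun x hx => ⟨hx, ?_⟩
  have hq0 : (0 : ℝ) < q := by exact_mod_cast Nat.pos_of_ne_zero hq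
  set j : ℤ := ⌊(q * x - γ - 1) / q⌋ with hj
  refine ⟨1 + j * q, ?_, ?_⟩
  · rw [← Int.isCoprime_iff_gcd_eq_one]
    exact isCoprime_one_left.add_mul_right_left j
  · have h1 := Int.floor_le ((q * x - γ - 1) / q)
    have h2 := Int.lt_floor_add_one ((q * x - γ - 1) / q)
    rw [← hj, le_div_iff₀ hq0] at h1
    rw [← hj, div_lt_iff₀ hq0] at h2
    have e : x - (((1 + j * q : ℤ) : ℝ) + γ) / q = (q * x - γ - 1 - j * q) / q := by
      push_cast
      field_simp
      ring
    rw [e, abs_div, abs_of_pos hq0]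
    refine div_le_div_of_nonneg_right (le_trans ?_ hψ) hq0.le
    rw [abs_le]
    constructor <;> linarith

theorem limsup_coprimeApproxSet_subset (γ : ℝ) (ψ : ℕ → ℝ≥0) :
    limsup (fun q : ℕ => coprimeApproxSet γ ψ q) atTop ⊆ Set.Icc 0 1 := by
  intro x hx
  rw [Filter.mem_limsup_iff_frequently_mem] at hx
  obtain ⟨q, hq⟩ := hx.exists
  exact hq.1

theorem theorem5p2 (γ δ : ℝ) (hδ : 0 < δ) (ψ : ℕ → ℝ≥0)
    (hψ : ∀ q : ℕ, 1 ≤ q → ψ q ≠ 0 → δ ≤ (ψ q : ℝ))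
    (hdiv : Tendsto
      (fun Q : ℕ => ∑ q ∈ Finset.Icc 1 Q, (Nat.totient q : ℝ) * (ψ q : ℝ) / (q : ℝ))
      atTop atTop) :
    volume (limsup (fun q : ℕ => coprimeApproxSet γ ψ q) atTop) = 1 := by
  have hsub := limsup_coprimeApproxSet_subset γ ψ
  suffices h : volume (Set.Icc (0 : ℝ) 1 \ limsup (fun q : ℕ => coprimeApproxSet γ ψ q) atTop) = 0 by
    have h1 : volume (limsup (fun q : ℕ => coprimeApproxSet γ ψ q) atTop) =
        volume (Set.Icc (0 : ℝ) 1) :=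
      le_antisymm (measure_mono hsub) (measure_mono_ae (ae_le_set.2 h))
    rw [h1, Real.volume_Icc]
    simp
  -- If `ψ q ≥ q` infinitely often, infinitely many sets are all of `[0, 1]`; otherwise the mass
  -- lower bound is available.
  by_cases hbig : ∃ᶠ q : ℕ in atTop, (q : ℝ) ≤ ψ q
  · have : Set.Icc (0 : ℝ) 1 \ limsup (fun q : ℕ => coprimeApproxSet γ ψ q) atTop = ∅ := by
      rw [Set.sdiff_eq_empty]
      intro x hx
      rw [Filter.mem_limsup_iff_frequently_mem]
      refine (hbig.and_eventually (eventually_ne_atTop 0)).mono fun q hq => ?_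
      rw [coprimeApproxSet_eq_Icc γ ψ hq.2 hq.1]
      exact hx
    rw [this, measure_empty]
  have hsmall : ∀ᶠ q : ℕ in atTop, (ψ q : ℝ) < q := by
    rw [not_frequently] at hbig
    exact hbig.mono fun q hq => not_le.1 hq
  obtain ⟨C, hC, hpair⟩ := exists_setIntegral_approxCount_mul_le γ hδ
  -- Restricting to finitely many numerators makes the sets closed and can only shrink the limsup.
  set E : ℕ → Set ℝ := fun q => Set.Icc (0 : ℝ) 1 ∩
    ⋃ a ∈ coprimeNumerators γ q, Metric.closedBall (((a : ℝ) + γ) / q) (ψ q / q) with hE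
  have hEsub : ∀ q, E q ⊆ coprimeApproxSet γ ψ q := by
    rintro q x ⟨hx, hxa⟩
    obtain ⟨a, ha, hxa⟩ := Set.mem_iUnion₂.1 hxa
    exact ⟨hx, a, (mem_coprimeNumerators.1 ha).2, by rwa [Metric.mem_closedBall, Real.dist_eq] at hxa⟩
  have hzero : ∀ N, volume (Set.Icc (0 : ℝ) 1 \ ⋃ q ≥ N, E q) = 0 := by
    refine volume_Icc_diff_iUnion_eq_zero (f := approxCount γ ψ)
      (w := fun q => (q.totient : ℝ) * ψ q / q) (c := 1 / 2) (by norm_num) hC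
      (fun q => by positivity) (fun q => ?_) (fun q x hx hxE => ?_)
      (integrable_approxCount γ ψ) (integrable_approxCount_mul γ ψ)
      (fun u v hu huv hv => eventually_le_setIntegral_approxCount γ ψ hsmall hu huv hv)
      (fun q r hq hr => hpair ψ q r _ hq hr (hψ q (Nat.one_le_iff_ne_zero.2 hq))
        (hψ r (Nat.one_le_iff_ne_zero.2 hr))) hdiv
    · exact isClosed_Icc.inter ((Finset.finite_toSet _).isClosed_biUnion fun a _ =>
        Metric.isClosed_closedBall)
    · refine Finset.sum_eq_zero fun a ha => Set.indicator_of_notMem (fun hxa => hxE ⟨hx, ?_⟩) _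
      exact Set.mem_iUnion₂.2 ⟨a, ha, hxa⟩
  refine measure_mono_null (t := ⋃ N, (Set.Icc (0 : ℝ) 1 \ ⋃ q ≥ N, E q)) ?_
    (measure_iUnion_null hzero)
  rintro x ⟨hx, hxl⟩
  rw [Filter.mem_limsup_iff_frequently_mem, not_frequently, eventually_atTop] at hxl
  obtain ⟨N, hN⟩ := hxl
  refine Set.mem_iUnion.2 ⟨N, hx, fun hxU => ?_⟩
  obtain ⟨q, hq, hxq⟩ := Set.mem_iUnion₂.1 hxU
  exact hN q hq (hEsub q hxq)
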